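/- Let $N\ge 1$ be an integer, let $p,q>1$ and $M>0$ be real numbers, and consider the equation $$-\Delta u=|u|^{p-1}u+M|\nabla u|^q\qquad\text{in }\mathbb{R}^N. \tag{E}$$ A radial ground state of (E) is a positive solution $u\in C^2(\mathbb{R}^N)$ of (E) such that $u(x)$ depends only on $|x|$. 1. Let $p>1$ and $q>\frac{2p}{p+1}$. Then there exists $M_0>0$, depending on $N,p,q$, such that for every $M>M_0$ equation (E) has no radial ground state $u$ with $u(0)=1$. 2. Let $p>1$, and assume moreover $p<\frac{N+2}{N-2}$ if $N\ge 3$. If $1<q\le p$, then for every $M>0$ equation (E) has no radial ground state. If $q>p$, then there exists $M_0>0$, depending on $N,p,q$, such that for every $M\in(0,M_0)$ equation (E) has no radial ground state $u$ with $u(0)=1$. 3. Let $N\ge 3$, $p>\frac{N+2}{N-2}$ and $q\ge\frac{2p}{p+1}$. Then there exists $M_0>0$, depending on $N,p,q$, such that for every $M\in(0,M_0)$ equation (E) has a radial ground state $u$ with $u(0)=1$. -/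

import Mathlib

/-- `u` is a classical (`C²`) solution on the whole of `ℝᴺ` of the equation
`-Δu = |u|^(p-1) u + M |∇u|^q`. -/
def IsEntireSolution (N : ℕ) (p q M : ℝ) (u : EuclideanSpace ℝ (Fin N) → ℝ) : Prop :=
  ContDiff ℝ 2 u ∧
    ∀ x, -(Laplacian.laplacian u x) = |u x| ^ (p - 1) * u x + M * ‖gradient u x‖ ^ q

/-- A radial ground state: a positive solution on the whole of `ℝᴺ` whose value at `x` depends
only on `‖x‖`. -/
structure IsRadialGroundState (N : ℕ) (p q M : ℝ) (u : EuclideanSpace ℝ (Fin N) → ℝ) : Prop where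
  solution : IsEntireSolution N p q M u
  pos : ∀ x, 0 < u x
  radial : ∀ x y, ‖x‖ = ‖y‖ → u x = u y

/-! Write `N = n + 1` and `w = -u'`. The equation becomes `u' = -w`, `w' = u ^ p + M * |w| ^ q - n *
w / r`.

Nonexistence rests on three bounds for a global positive profile: `M * r * w ^ (q - 1) ≤ n`
(`mul_rpow_le`), `r * w ≤ (n - 1) * u` (`mul_w_le`) and `r * u ^ p ≤ (n + 1) * w`
(`mul_rpow_le_mul_w`). If either of the first two failed, `w` would stay above some `η / r` and `u`
would become negative. When `u 0 = 1`, the value `w 1` is bounded below independently of `M`, so the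
first bound at `r = 1` excludes large `M`.

In the subcritical range a Pohozaev function `J`, corrected by a multiple of `M * u * w ^ q`,
satisfies `J' > g * J` with `g ≥ 0` and `J 0 = 0`. It is therefore positive and nondecreasing,
whereas the bounds force `J → 0` at infinity (`subcritical_contradiction`). The sign condition on
`J'` holds for every `M` if `q ≤ p`, and for small `M` if `q > p`.

In the supercritical range the powers are truncated so that the initial value problem is globally
solvable. The uncorrected Pohozaev function starts decreasing from `0`. While it is negative, `u` is
positive and `r * w ^ (q - 1)` is bounded, so for small `M` it cannot climb back. Hence `u > 0`
throughout, `w` never reaches the truncation level, and the original equation is solved. -/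

section RadialCalculus

/-! ### Gradient and Laplacian of radial functions -/

variable {E : Type*} [NormedAddCommGroup E] [InnerProductSpace ℝ E]

theorem hasFDerivAt_norm_of_ne_zero {x : E} (hx : x ≠ 0) :
    HasFDerivAt (fun y : E => ‖y‖) (‖x‖⁻¹ • innerSL ℝ x) x := by
  have hx' : ‖x‖ ≠ 0 := norm_ne_zero_iff.2 hx
  have h := (hasStrictFDerivAt_norm_sq x).hasFDerivAt.sqrt (pow_ne_zero 2 hx')
  have h2 : (fun y : E => √(‖y‖ ^ 2)) = fun y => ‖y‖ := by
    ext y; exact Real.sqrt_sq (norm_nonneg y)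
  rw [h2, Real.sqrt_sq (norm_nonneg x)] at h
  convert h using 1
  ext v
  simp
  field_simp

theorem HasDerivAt.hasGradientAt_comp_norm [CompleteSpace E] {U : ℝ → ℝ} {d : ℝ} {x : E}
    (hx : x ≠ 0) (h : HasDerivAt U d ‖x‖) :
    HasGradientAt (fun y : E => U ‖y‖) ((d / ‖x‖) • x) x := by
  rw [hasGradientAt_iff_hasFDerivAt]
  convert! h.comp_hasFDerivAt x (hasFDerivAt_norm_of_ne_zero hx) using 1
  ext v
  simp [InnerProductSpace.toDual_apply_apply]
  ring

theorem HasDerivAt.hasFDerivAt_norm_smul {k : ℝ → ℝ} {d : ℝ} {x : E}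
    (hx : x ≠ 0) (h : HasDerivAt k d ‖x‖) :
    HasFDerivAt (fun y : E => k ‖y‖ • y)
      (k ‖x‖ • ContinuousLinearMap.id ℝ E + (d / ‖x‖) • (innerSL ℝ x).smulRight x) x := by
  convert! (h.comp_hasFDerivAt x (hasFDerivAt_norm_of_ne_zero hx)).smul (hasFDerivAt_id x) using 1
  ext v
  simp [smul_smul, div_eq_mul_inv]

/-- A radial Hessian is a multiple of the identity plus a multiple of `x ⊗ x`; this is its trace. -/
theorem sum_inner_radial_hessian (a d : ℝ) (x : E) {ι : Type*} [Fintype ι]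
    (b : OrthonormalBasis ι ℝ E) :
    ∑ i, inner ℝ ((a • ContinuousLinearMap.id ℝ E + d • (innerSL ℝ x).smulRight x) (b i)) (b i)
      = a * Fintype.card ι + d * ‖x‖ ^ 2 := by
  have h : ∀ i, inner ℝ ((a • ContinuousLinearMap.id ℝ E +
      d • (innerSL ℝ x).smulRight x) (b i)) (b i) = a + d * ‖inner ℝ x (b i)‖ ^ 2 := by
    intro i
    simp [inner_add_left, inner_smul_left]
    left
    ring
  simp_rw [h]
  rw [Finset.sum_add_distrib, ← Finset.mul_sum, b.sum_sq_norm_inner_left]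
  simp [mul_comm]

variable [FiniteDimensional ℝ E]

theorem laplacian_eq_sum_of_hasGradientAt {f : E → ℝ} {F : E → E} {F' : E →L[ℝ] E} {x : E}
    {ι : Type*} [Fintype ι] (b : OrthonormalBasis ι ℝ E)
    (hf : ContDiffAt ℝ 2 f x) (hF : ∀ᶠ y in nhds x, HasGradientAt f (F y) y)
    (hF' : HasFDerivAt F F' x) :
    Laplacian.laplacian f x = ∑ i, inner ℝ (F' (b i)) (b i) := by
  rw [InnerProductSpace.laplacian_eq_iteratedFDeriv_orthonormalBasis f b]
  refine Finset.sum_congr rfl fun i _ => ?_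
  rw [iteratedFDeriv_two_apply]
  have hd : DifferentiableAt ℝ (fderiv ℝ f) x :=
    (hf.fderiv_right (m := 1) (by norm_num)).differentiableAt (by norm_num)
  have h1 : HasFDerivAt (fun y => fderiv ℝ f y (b i))
      ((fderiv ℝ (fderiv ℝ f) x).flip (b i)) x := by
    simpa using hd.hasFDerivAt.clm_apply (hasFDerivAt_const (b i) x)
  have h2 : HasFDerivAt (fun y => inner ℝ (F y) (b i)) ((innerSL ℝ (b i)).comp F') x := by
    have := (innerSL ℝ (b i)).hasFDerivAt.comp x hF'
    refine this.congr_of_eventuallyEq (Filter.Eventually.of_forall fun y => ?_)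
    simp [real_inner_comm]
  have h3 : (fun y => fderiv ℝ f y (b i)) =ᶠ[nhds x] fun y => inner ℝ (F y) (b i) := by
    filter_upwards [hF] with y hy
    rw [hy.hasFDerivAt.fderiv]
    simp [InnerProductSpace.toDual_apply_apply]
  have h4 := h1.unique (h2.congr_of_eventuallyEq h3)
  have h5 := congrArg (fun T => T (b i)) h4
  simpa [real_inner_comm] using h5

theorem contDiff_two_of_hasGradientAt {f : E → ℝ} {F : E → E} {F' : E → E →L[ℝ] E}
    (hF : ∀ y, HasGradientAt f (F y) y) (hF' : ∀ y, HasFDerivAt F (F' y) y)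
    (hc : Continuous F') : ContDiff ℝ 2 f := by
  have hF1 : ContDiff ℝ 1 F := by
    rw [contDiff_one_iff_fderiv]
    refine ⟨fun y => (hF' y).differentiableAt, ?_⟩
    rwa [show fderiv ℝ F = F' from funext fun y => (hF' y).fderiv]
  rw [show (2 : WithTop ℕ∞) = 1 + 1 by norm_num, contDiff_succ_iff_fderiv]
  refine ⟨fun y => (hF y).differentiableAt, by simp, ?_⟩
  rw [contDiff_clm_apply_iff]
  intro v
  have : (fun y => fderiv ℝ f y v) = fun y => inner ℝ (F y) v := by
    ext y
    rw [(hF y).hasFDerivAt.fderiv]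
    simp [InnerProductSpace.toDual_apply_apply]
  rw [this]
  exact hF1.inner ℝ contDiff_const

end RadialCalculus

/-! ### Passage between the PDE and the radial system -/

/-- A positive solution `u` on `[0, ∞)` of the radial equation in dimension `n + 1`, written as a
first order system with `w = -u'`. -/
structure IsRadialProfile (n : ℕ) (p q M : ℝ) (u w : ℝ → ℝ) : Prop where
  continuous_w : Continuous w
  w_zero : w 0 = 0
  u_pos : ∀ r, 0 < u r
  hasDerivAt_u : ∀ r, HasDerivAt u (-w r) r
  hasDerivAt_w : ∀ r, 0 < r →
    HasDerivAt w (u r ^ p + M * |w r| ^ q - n * w r / r) r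

theorem IsRadialGroundState.exists_radialProfile {n : ℕ} {p q M : ℝ}
    {u : EuclideanSpace ℝ (Fin (n + 1)) → ℝ} (h : IsRadialGroundState (n + 1) p q M u) :
    ∃ U w : ℝ → ℝ, IsRadialProfile n p q M U w ∧ U 0 = u 0 := by
  set e : EuclideanSpace ℝ (Fin (n + 1)) := EuclideanSpace.single 0 1 with he
  have hen : ‖e‖ = 1 := by simp [he]
  have hre : ∀ r : ℝ, 0 ≤ r → ‖r • e‖ = r := fun r hr => by
    rw [norm_smul, hen, mul_one, Real.norm_of_nonneg hr]
  set U : ℝ → ℝ := fun t => u (t • e) with hU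
  have hUc : ContDiff ℝ 2 U :=
    h.solution.1.comp (contDiff_id.smul contDiff_const)
  have huU : ∀ y, u y = U ‖y‖ := fun y => h.radial _ _ (by rw [hre _ (norm_nonneg y)])
  have hUd : ∀ r, HasDerivAt U (deriv U r) r := fun r =>
    (hUc.differentiable (by norm_num) r).hasDerivAt
  have hU1 : ContDiff ℝ 1 (deriv U) := by
    have : ContDiff ℝ (1 + 1) U := by simpa [one_add_one_eq_two] using hUc
    exact (contDiff_succ_iff_deriv.1 this).2.2
  have hU2 : ∀ r, HasDerivAt (deriv U) (deriv (deriv U) r) r := fun r =>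
    (hU1.differentiable (by norm_num) r).hasDerivAt
  refine ⟨U, fun r => -deriv U r, ⟨hU1.continuous.neg, ?_, fun r => h.pos _, ?_, ?_⟩, by simp [hU]⟩
  · have hev : ∀ r, U (-r) = U r := fun r => h.radial _ _ (by simp)
    have h1 : HasDerivAt (fun r => U (-r)) (-deriv U 0) 0 := by
      have := (hUd (-0)).comp (0 : ℝ) (hasDerivAt_neg (0 : ℝ))
      simpa [Function.comp_def] using this
    simp only [hev] at h1
    have := h1.unique (hUd 0)
    linarith
  · intro r
    simpa using hUd r
  · intro r hr
    have hx : r • e ≠ 0 := by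
      rw [← norm_ne_zero_iff, hre r hr.le]; exact hr.ne'
    have hxn := hre r hr.le
    set k : ℝ → ℝ := fun s => deriv U s / s with hk
    have hkd : HasDerivAt k ((deriv (deriv U) r * r - deriv U r * 1) / r ^ 2) ‖r • e‖ := by
      rw [hxn]
      exact (hU2 r).div (hasDerivAt_id r) hr.ne'
    have hgrad : ∀ y : EuclideanSpace ℝ (Fin (n + 1)), y ≠ 0 → HasGradientAt u (k ‖y‖ • y) y := by
      intro y hy
      rw [show u = fun y => U ‖y‖ from funext huU]
      exact (hUd ‖y‖).hasGradientAt_comp_norm hy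
    have hev : ∀ᶠ y in nhds (r • e), HasGradientAt u (k ‖y‖ • y) y := by
      filter_upwards [isOpen_ne.mem_nhds hx] with y hy using hgrad y hy
    have hlap := laplacian_eq_sum_of_hasGradientAt (EuclideanSpace.basisFun (Fin (n + 1)) ℝ)
      h.solution.1.contDiffAt hev (hkd.hasFDerivAt_norm_smul hx)
    rw [sum_inner_radial_hessian, hxn] at hlap
    have heq := h.solution.2 (r • e)
    rw [hlap, (hgrad _ hx).gradient, norm_smul, hxn, huU, hxn] at heq
    have hUp := h.pos (r • e)
    change 0 < U r at hUp
    have hn : ‖k r‖ * r = |deriv U r| := by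
      simp only [hk, norm_div, Real.norm_eq_abs, abs_of_pos hr]
      field_simp
    rw [hn, abs_of_pos hUp, Real.rpow_sub_one hUp.ne', div_mul_cancel₀ _ hUp.ne'] at heq
    refine (hU2 r).neg.congr_deriv ?_
    rw [abs_neg, ← heq]
    simp only [hk, Fintype.card_fin]
    push_cast
    field_simp
    ring

/-- The function `x ↦ u ‖x‖` is a classical solution of `-Δ = h (‖x‖)` when `u' = -r K` and
`(r ^ (n + 1) K)' = r ^ n h`. -/
theorem radial_solution_of_integrated {n : ℕ} {u K h : ℝ → ℝ} (hK : Continuous K)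
    (hh : Continuous h) (hK0 : (n + 1) * K 0 = h 0)
    (hu : ∀ r, 0 ≤ r → HasDerivAt u (-(r * K r)) r)
    (hKd : ∀ r, 0 < r → HasDerivAt K ((h r - (n + 1) * K r) / r) r) :
    ContDiff ℝ 2 (fun x : EuclideanSpace ℝ (Fin (n + 1)) => u ‖x‖) ∧
    (∀ x : EuclideanSpace ℝ (Fin (n + 1)),
      -(Laplacian.laplacian (fun x : EuclideanSpace ℝ (Fin (n + 1)) => u ‖x‖) x) = h ‖x‖) ∧
    (∀ x : EuclideanSpace ℝ (Fin (n + 1)),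
      gradient (fun x : EuclideanSpace ℝ (Fin (n + 1)) => u ‖x‖) x = -K ‖x‖ • x) := by
  set E := EuclideanSpace ℝ (Fin (n + 1))
  have hgrad : ∀ x : E, HasGradientAt (fun x : E => u ‖x‖) (-K ‖x‖ • x) x := by
    intro x
    by_cases hx : x = 0
    · subst hx
      rw [hasGradientAt_iff_hasFDerivAt, hasFDerivAt_iff_isLittleO_nhds_zero]
      have h0 := hu 0 le_rfl
      rw [hasDerivAt_iff_isLittleO_nhds_zero] at h0
      have ht : Filter.Tendsto (fun x : E => ‖x‖) (nhds 0) (nhds 0) := by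
        simpa using (continuous_norm (E := E)).tendsto 0
      rw [← Asymptotics.isLittleO_norm_right]
      simpa [Function.comp_def] using h0.comp_tendsto ht
    · have hx' : ‖x‖ ≠ 0 := norm_ne_zero_iff.2 hx
      convert (hu ‖x‖ (norm_nonneg x)).hasGradientAt_comp_norm hx using 2
      field_simp
  set F' : E → E →L[ℝ] E := fun x => -K ‖x‖ • ContinuousLinearMap.id ℝ E +
    (-((h ‖x‖ - (n + 1) * K ‖x‖) / ‖x‖) / ‖x‖) • (innerSL ℝ x).smulRight x with hF'def
  have hF' : ∀ x : E, HasFDerivAt (fun y : E => -K ‖y‖ • y) (F' x) x := by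
    intro x
    by_cases hx : x = 0
    · subst hx
      have hF0 : F' 0 = -K 0 • ContinuousLinearMap.id ℝ E := by simp [hF'def]
      rw [hF0, hasFDerivAt_iff_isLittleO_nhds_zero]
      have h1 : (fun y : E => -K ‖0 + y‖ • (0 + y) - -K ‖(0 : E)‖ • (0 : E) -
          (-K 0 • ContinuousLinearMap.id ℝ E) y) = fun y => (K 0 - K ‖y‖) • y := by
        ext1 y
        simp
        module
      rw [h1]
      have h2 : (fun y : E => K 0 - K ‖y‖) =o[nhds 0] fun _ => (1 : ℝ) := by
        rw [Asymptotics.isLittleO_one_iff]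
        have : Continuous fun y : E => K 0 - K ‖y‖ := by fun_prop
        simpa using this.tendsto 0
      simpa using h2.smul_isBigO (Asymptotics.isBigO_refl (fun y : E => y) (nhds 0))
    · exact (hKd ‖x‖ (norm_pos_iff.2 hx)).neg.hasFDerivAt_norm_smul hx
  have hc : Continuous F' := by
    rw [continuous_iff_continuousAt]
    intro x
    refine ContinuousAt.add (by fun_prop) ?_
    by_cases hx : x = 0
    · subst hx
      -- Away from the origin the rank-one part of `F'` has norm exactly `|h - (n + 1) * K|`: the
      -- factor `‖x‖ ^ 2` cancels both divisions. By `hK0` this tends to `0` at the origin.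
      have hm : Continuous fun x : E => |h ‖x‖ - (n + 1) * K ‖x‖| := by fun_prop
      have hm0 := hm.tendsto 0
      simp only [norm_zero, hK0, sub_self, abs_zero] at hm0
      rw [ContinuousAt]
      have h0 : (-((h ‖(0 : E)‖ - (n + 1) * K ‖(0 : E)‖) / ‖(0 : E)‖) / ‖(0 : E)‖) •
          (innerSL ℝ (0 : E)).smulRight (0 : E) = 0 := by simp
      rw [h0]
      refine squeeze_zero_norm (fun y => ?_) hm0
      rw [norm_smul, ContinuousLinearMap.norm_smulRight_apply, innerSL_apply_norm]
      by_cases hy : y = 0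
      · simp [hy]
      · have hy' : 0 < ‖y‖ := norm_pos_iff.2 hy
        rw [norm_div, norm_neg, norm_div, norm_norm, Real.norm_eq_abs]
        apply le_of_eq
        field_simp
    · have hx' : ‖x‖ ≠ 0 := norm_ne_zero_iff.2 hx
      refine ContinuousAt.fun_smul ?_ ?_
      · fun_prop (disch := exact hx')
      · exact (((ContinuousLinearMap.smulRightL ℝ E E).continuous.comp
          (innerSL ℝ).continuous).clm_apply continuous_id).continuousAt
  have hC2 := contDiff_two_of_hasGradientAt hgrad hF' hc
  refine ⟨hC2, fun x => ?_, fun x => (hgrad x).gradient⟩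
  rw [laplacian_eq_sum_of_hasGradientAt (EuclideanSpace.basisFun (Fin (n + 1)) ℝ)
    hC2.contDiffAt (Filter.Eventually.of_forall hgrad) (hF' x), sum_inner_radial_hessian]
  simp only [Fintype.card_fin]
  push_cast
  by_cases hx : x = 0
  · subst hx
    simp
    linarith
  · have hx' : ‖x‖ ≠ 0 := norm_ne_zero_iff.2 hx
    field_simp
    ring

/-! ### A priori bounds for global positive profiles -/

section GroundStates

open Set Filter Topology
open scoped BoundedContinuousFunction NNReal

namespace IsRadialProfile

variable {n : ℕ} {p q M : ℝ} {u w : ℝ → ℝ}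

theorem continuous_u (h : IsRadialProfile n p q M u w) : Continuous u :=
  continuous_iff_continuousAt.2 fun r => (h.hasDerivAt_u r).continuousAt

/-- The flux `r ^ n w` has derivative `r ^ n (u ^ p + M |w| ^ q)`. -/
theorem hasDerivAt_flux (h : IsRadialProfile n p q M u w) {r : ℝ} (hr : 0 < r) :
    HasDerivAt (fun r => r ^ n * w r) (r ^ n * (u r ^ p + M * |w r| ^ q)) r := by
  refine ((hasDerivAt_pow n r).mul (h.hasDerivAt_w r hr)).congr_deriv ?_
  rcases n with _ | n
  · simp
  · simp only [Nat.add_sub_cancel, pow_succ]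
    field_simp
    ring

theorem w_pos (h : IsRadialProfile n p q M u w) (hM : 0 < M) {r : ℝ} (hr : 0 < r) : 0 < w r := by
  have hmono : StrictMonoOn (fun r => r ^ n * w r) (Ici 0) := by
    refine strictMonoOn_of_deriv_pos (convex_Ici 0)
      ((continuous_pow n).mul h.continuous_w).continuousOn fun s hs => ?_
    rw [interior_Ici] at hs
    have hs' : 0 < s := hs
    rw [(h.hasDerivAt_flux hs').deriv]
    have := Real.rpow_pos_of_pos (h.u_pos s) p
    positivity
  have := hmono self_mem_Ici hr.le hr
  simp only [h.w_zero, mul_zero] at this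
  exact pos_of_mul_pos_right this (by positivity)

theorem hasDerivAt_w' (h : IsRadialProfile n p q M u w) (hM : 0 < M) {r : ℝ} (hr : 0 < r) :
    HasDerivAt w (u r ^ p + M * w r ^ q - n * w r / r) r := by
  have := h.hasDerivAt_w r hr
  rwa [abs_of_pos (h.w_pos hM hr)] at this

theorem antitoneOn_u (h : IsRadialProfile n p q M u w) (hM : 0 < M) : AntitoneOn u (Ici 0) := by
  refine antitoneOn_of_deriv_nonpos (convex_Ici 0) h.continuous_u.continuousOn
    (fun s _ => (h.hasDerivAt_u s).differentiableAt.differentiableWithinAt) fun s hs => ?_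
  rw [interior_Ici] at hs
  rw [(h.hasDerivAt_u s).deriv]
  linarith [h.w_pos hM hs]

/-- A positive profile cannot have `r w` bounded below by a positive constant near infinity. -/
theorem not_eventually_div_le (h : IsRadialProfile n p q M u w) {r₀ η : ℝ} (hr₀ : 0 < r₀)
    (hη : 0 < η) (hw : ∀ r, r₀ ≤ r → η / r ≤ w r) : False := by
  have hanti : AntitoneOn (fun r => u r + η * Real.log r) (Ici r₀) := by
    have hd : ∀ s, 0 < s → HasDerivAt (fun r => u r + η * Real.log r) (-w s + η * s⁻¹) s :=
      fun s hs => (h.hasDerivAt_u s).add ((Real.hasDerivAt_log hs.ne').const_mul η)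
    refine antitoneOn_of_deriv_nonpos (convex_Ici r₀)
      (fun s hs => (hd s (hr₀.trans_le hs)).continuousAt.continuousWithinAt)
      (fun s hs => ?_) fun s hs => ?_
    · rw [interior_Ici] at hs
      exact (hd s (hr₀.trans hs)).differentiableAt.differentiableWithinAt
    · rw [interior_Ici] at hs
      rw [(hd s (hr₀.trans hs)).deriv]
      have := hw s (le_of_lt hs)
      rw [div_eq_mul_inv] at this
      linarith
  have ht : Tendsto (fun r => η * Real.log r) atTop atTop :=
    Real.tendsto_log_atTop.const_mul_atTop hη
  obtain ⟨r, hr1, hr2⟩ := ((ht.eventually_gt_atTop (u r₀ + η * Real.log r₀)).and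
    (eventually_ge_atTop r₀)).exists
  have h1 := hanti self_mem_Ici hr2 hr2
  have h2 := h.u_pos r
  simp only at h1
  linarith

/-- On a global positive profile the gradient term never makes `w` increase by itself. -/
theorem mul_rpow_le (h : IsRadialProfile n p q M u w) (hM : 0 < M) {r : ℝ} (hr : 0 < r) :
    M * r * w r ^ (q - 1) ≤ n := by
  by_contra! hlt
  have hw0 := h.w_pos hM hr
  -- If the bound fails at `r`, then `M * x * w r ^ (q - 1) > n` for all `x ≥ r`. So wherever `w`
  -- equals `w r` again its derivative is positive, and `w` cannot cross that level downwards.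
  have hge : ∀ s, r ≤ s → w r ≤ w s := by
    intro s hs
    have := image_le_of_deriv_right_lt_deriv_boundary' (f := fun s => -w s)
      (f' := fun s => -(u s ^ p + M * w s ^ q - n * w s / s)) (a := r) (b := s)
      (B := fun _ => -w r) (B' := fun _ => 0)
      h.continuous_w.neg.continuousOn
      (fun x hx => (h.hasDerivAt_w' hM (hr.trans_le hx.1)).neg.hasDerivWithinAt)
      le_rfl continuousOn_const (fun x _ => hasDerivWithinAt_const _ _ _) ?_
      (right_mem_Icc.2 hs)
    · linarith
    · intro x hx hxe
      have hx0 : 0 < x := hr.trans_le hx.1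
      have hxe' : w x = w r := by linarith
      have h1 : (n : ℝ) < M * x * w r ^ (q - 1) := by
        refine hlt.trans_le ?_
        gcongr
        exact hx.1
      have h2 := Real.rpow_pos_of_pos (h.u_pos x) p
      have h3 : w r ^ q = w r ^ (q - 1) * w r := by
        rw [Real.rpow_sub_one hw0.ne', div_mul_cancel₀ _ hw0.ne']
      rw [hxe', h3]
      have h4 : n * w r / x < M * (w r ^ (q - 1) * w r) := by
        rw [div_lt_iff₀ hx0]
        nlinarith
      linarith
  refine h.not_eventually_div_le hr (mul_pos hr hw0) fun s hs => ?_
  have hs0 : 0 < s := hr.trans_le hs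
  rw [div_le_iff₀ hs0]
  have := hge s hs
  nlinarith

/-- The quantity `(n - 1) * u - r * w` has derivative `-r * (u ^ p + M * w ^ q)`. Once negative it
stays below a negative constant, which bounds `r * w` away from zero. -/
theorem mul_w_le (h : IsRadialProfile n p q M u w) (hM : 0 < M) (hn : 1 ≤ n) {r : ℝ} (hr : 0 < r) :
    r * w r ≤ (n - 1) * u r := by
  by_contra! hlt
  have hn' : (1 : ℝ) ≤ n := by exact_mod_cast hn
  have hanti : AntitoneOn (fun r => (n - 1) * u r - r * w r) (Ici r) := by
    have hd : ∀ s, 0 < s → HasDerivAt (fun r => (n - 1) * u r - r * w r)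
        (-(s * (u s ^ p + M * w s ^ q))) s := fun s hs => by
      refine (((h.hasDerivAt_u s).const_mul ((n : ℝ) - 1)).sub
        ((hasDerivAt_id s).mul (h.hasDerivAt_w' hM hs))).congr_deriv ?_
      simp only [id]
      field_simp
      ring
    refine antitoneOn_of_deriv_nonpos (convex_Ici r)
      (fun s hs => (hd s (hr.trans_le hs)).continuousAt.continuousWithinAt)
      (fun s hs => ?_) fun s hs => ?_
    · rw [interior_Ici] at hs
      exact (hd s (hr.trans hs)).differentiableAt.differentiableWithinAt
    · rw [interior_Ici] at hs
      have hs0 : 0 < s := hr.trans hs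
      rw [(hd s hs0).deriv]
      have := Real.rpow_pos_of_pos (h.u_pos s) p
      have := Real.rpow_pos_of_pos (h.w_pos hM hs0) q
      rw [neg_nonpos]
      positivity
  refine h.not_eventually_div_le hr (sub_pos.2 hlt) fun s hs => ?_
  have hs0 : 0 < s := hr.trans_le hs
  rw [div_le_iff₀ hs0]
  have h1 := hanti self_mem_Ici hs hs
  simp only at h1
  have h2 : 0 ≤ ((n : ℝ) - 1) * u s := mul_nonneg (by linarith) (h.u_pos s).le
  linarith

/-- Since `u` is nonincreasing, the flux `∫ s ^ n * (u ^ p + M * w ^ q)` is at least `u r ^ p * r ^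
(n + 1) / (n + 1)`. The proof differentiates the difference of the two sides. -/
theorem mul_rpow_le_mul_w (h : IsRadialProfile n p q M u w) (hM : 0 < M) (hp : 1 < p) {r : ℝ}
    (hr : 0 < r) : r * u r ^ p ≤ (n + 1) * w r := by
  have hmono : MonotoneOn (fun r => (n + 1) * (r ^ n * w r) - r ^ (n + 1) * u r ^ p) (Ici 0) := by
    have hd : ∀ s, 0 < s → HasDerivAt
        (fun r => (n + 1) * (r ^ n * w r) - r ^ (n + 1) * u r ^ p)
        ((n + 1) * (s ^ n * (M * w s ^ q)) + s ^ (n + 1) * (w s * p * u s ^ (p - 1))) s := by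
      intro s hs
      refine (((h.hasDerivAt_flux hs).const_mul ((n : ℝ) + 1)).sub
        ((hasDerivAt_pow (n + 1) s).mul
          ((h.hasDerivAt_u s).rpow_const (Or.inl (h.u_pos s).ne')))).congr_deriv ?_
      rw [abs_of_pos (h.w_pos hM hs)]
      push_cast
      simp
      ring
    refine monotoneOn_of_deriv_nonneg (convex_Ici 0) ?_ (fun s hs => ?_) fun s hs => ?_
    · have := h.continuous_w
      have h2 := h.continuous_u
      have h3 : Continuous fun r => u r ^ p := h2.rpow_const fun r => Or.inr (by linarith)
      exact Continuous.continuousOn (by fun_prop)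
    · rw [interior_Ici] at hs
      exact (hd s hs).differentiableAt.differentiableWithinAt
    · rw [interior_Ici] at hs
      have hs' : 0 < s := hs
      rw [(hd s hs).deriv]
      have := Real.rpow_pos_of_pos (h.u_pos s) (p - 1)
      have := h.w_pos hM hs
      positivity
  have h1 := hmono self_mem_Ici (mem_Ici.2 hr.le) hr.le
  simp only [h.w_zero, mul_zero, zero_pow n.succ_ne_zero, zero_mul, sub_zero] at h1
  have h2 : 0 ≤ r ^ n * ((n + 1) * w r - r * u r ^ p) := by
    rw [pow_succ] at h1
    linarith
  linarith [nonneg_of_mul_nonneg_right h2 (by positivity)]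

/-- By `mul_rpow_le` the gradient term is dominated by `n * w / r`, so `w' ≤ u ^ p ≤ 1`. -/
theorem w_le_self (h : IsRadialProfile n p q M u w) (hM : 0 < M) (hp : 1 < p)
    (h0 : u 0 = 1) {r : ℝ} (hr : 0 ≤ r) : w r ≤ r := by
  have hanti : AntitoneOn (fun r => w r - r) (Ici 0) := by
    have hd : ∀ s, 0 < s → HasDerivAt (fun r => w r - r)
        (u s ^ p + M * w s ^ q - n * w s / s - 1) s := fun s hs =>
      (h.hasDerivAt_w' hM hs).sub (hasDerivAt_id s)
    refine antitoneOn_of_deriv_nonpos (convex_Ici 0)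
      (h.continuous_w.sub continuous_id).continuousOn (fun s hs => ?_) fun s hs => ?_
    · rw [interior_Ici] at hs
      exact (hd s hs).differentiableAt.differentiableWithinAt
    · rw [interior_Ici] at hs
      have hs' : 0 < s := hs
      rw [(hd s hs).deriv]
      have hw := h.w_pos hM hs
      have h1 : u s ^ p ≤ 1 := by
        refine Real.rpow_le_one (h.u_pos s).le ?_ (by linarith)
        rw [← h0]
        exact h.antitoneOn_u hM self_mem_Ici hs'.le hs'.le
      have h2 : M * w s ^ q ≤ n * w s / s := by
        rw [le_div_iff₀ hs', show w s ^ q = w s ^ (q - 1) * w s by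
          rw [Real.rpow_sub_one hw.ne', div_mul_cancel₀ _ hw.ne']]
        nlinarith [h.mul_rpow_le hM hs']
      linarith
  have := hanti self_mem_Ici hr hr
  simp only [h.w_zero] at this
  linarith

/-- From `w r ≤ r` one gets `u 1 ≥ 1 / 2`, hence `w 1 ≥ (1 / 2) ^ p / (n + 1)`, which is inserted
into `mul_rpow_le` at `r = 1`. -/
theorem le_of_u_zero_eq_one (h : IsRadialProfile n p q M u w) (hM : 0 < M) (hp : 1 < p)
    (hq : 1 < q) (h0 : u 0 = 1) : M * ((1 / 2) ^ p / (n + 1)) ^ (q - 1) ≤ n := by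
  have hu1 : 1 / 2 ≤ u 1 := by
    have hmono : MonotoneOn (fun r => u r + r ^ 2 / 2) (Ici 0) := by
      have hd : ∀ s, HasDerivAt (fun r => u r + r ^ 2 / 2) (-w s + s) s := fun s => by
        refine ((h.hasDerivAt_u s).add ((hasDerivAt_pow 2 s).div_const 2)).congr_deriv ?_
        simp
      refine monotoneOn_of_deriv_nonneg (convex_Ici 0)
        (fun s _ => (hd s).continuousAt.continuousWithinAt)
        (fun s _ => (hd s).differentiableAt.differentiableWithinAt) fun s hs => ?_
      rw [interior_Ici] at hs
      rw [(hd s).deriv]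
      linarith [h.w_le_self hM hp h0 (le_of_lt hs)]
    have := hmono self_mem_Ici (mem_Ici.2 zero_le_one) zero_le_one
    norm_num [h0] at this
    linarith
  have h1 := h.mul_rpow_le_mul_w hM hp one_pos
  have h2 : (1 / 2 : ℝ) ^ p ≤ u 1 ^ p := Real.rpow_le_rpow (by norm_num) hu1 (by linarith)
  have h3 : (1 / 2 : ℝ) ^ p / (n + 1) ≤ w 1 := by
    rw [div_le_iff₀ (by positivity)]
    linarith
  have h4 := h.mul_rpow_le hM one_pos
  refine le_trans ?_ h4
  rw [mul_one]
  gcongr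

end IsRadialProfile

/-! ### Decay estimates -/

/-- Pointwise decay of `u` forced by the bounds `r w ≤ A u` and `r u ^ p ≤ B w`. -/
theorem rpow_decay_of_le {p A B r u w : ℝ} (hp : 1 < p) (hB : 0 ≤ B) (hr : 0 < r)
    (hu : 0 < u) (h1 : r * w ≤ A * u) (h2 : r * u ^ p ≤ B * w) :
    u ≤ (A * B) ^ (1 / (p - 1)) * r ^ (-(2 / (p - 1))) := by
  have hp1 : 0 < p - 1 := by linarith
  -- Chaining the two bounds gives `r ^ 2 * u ^ p ≤ B * r * w ≤ A * B * u`.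
  have h3 : r ^ 2 * u ^ (p - 1) ≤ A * B := by
    have hup : u ^ p = u ^ (p - 1) * u := by
      rw [Real.rpow_sub_one hu.ne', div_mul_cancel₀ _ hu.ne']
    rw [hup] at h2
    have h4 : r ^ 2 * u ^ (p - 1) * u ≤ A * B * u := by
      nlinarith [mul_le_mul_of_nonneg_left h2 hr.le, mul_le_mul_of_nonneg_left h1 hB]
    exact le_of_mul_le_mul_right h4 hu
  have h5 : u ^ (p - 1) ≤ A * B * r ^ (-2 : ℝ) := by
    rw [Real.rpow_neg hr.le, Real.rpow_two, ← div_eq_mul_inv, le_div_iff₀ (by positivity)]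
    linarith
  have hAB : 0 ≤ A * B := le_trans (by positivity) h3
  have h6 := Real.rpow_le_rpow (by positivity) h5 (one_div_pos.2 hp1).le
  rw [← Real.rpow_mul hu.le, mul_one_div_cancel hp1.ne', Real.rpow_one,
    Real.mul_rpow hAB (by positivity), ← Real.rpow_mul hr.le] at h6
  convert h6 using 3
  ring

/-- Under the same bounds, `r w ^ (q - 1)` stays bounded on `[1, ∞)` when `q ≥ 2p / (p + 1)`. -/
theorem mul_rpow_bound_of_le {p q A B r u w : ℝ} (hp : 1 < p) (hq : 2 * p / (p + 1) ≤ q)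
    (hA : 0 ≤ A) (hB : 0 ≤ B) (hr : 1 ≤ r) (hu : 0 < u) (hw : 0 < w)
    (h1 : r * w ≤ A * u) (h2 : r * u ^ p ≤ B * w) :
    r * w ^ (q - 1) ≤ (A * (A * B) ^ (1 / (p - 1))) ^ (q - 1) := by
  have hp1 : 0 < p - 1 := by linarith
  have hr0 : 0 < r := by linarith
  rw [div_le_iff₀ (by linarith)] at hq
  have hq1 : 0 ≤ q - 1 := by nlinarith
  have h3 := rpow_decay_of_le hp hB hr0 hu h1 h2
  have h4 : w ≤ A * (A * B) ^ (1 / (p - 1)) * r ^ (-(2 / (p - 1)) - 1) := by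
    rw [Real.rpow_sub_one hr0.ne', ← mul_div_assoc, le_div_iff₀ hr0]
    nlinarith [mul_le_mul_of_nonneg_left h3 hA]
  have h5 := Real.rpow_le_rpow hw.le h4 hq1
  rw [Real.mul_rpow (by positivity) (by positivity), ← Real.rpow_mul hr0.le] at h5
  -- The condition `q ≥ 2p / (p + 1)` is equivalent to `(p + 1) * (q - 1) ≥ p - 1`, which makes the
  -- exponent at most `-1`.
  have h6 : r ^ ((-(2 / (p - 1)) - 1) * (q - 1)) ≤ r ^ (-1 : ℝ) := by
    apply Real.rpow_le_rpow_of_exponent_le hr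
    have : (-(2 / (p - 1)) - 1) * (q - 1) = -((p + 1) * (q - 1) / (p - 1)) := by
      field_simp; ring
    rw [this, neg_le_neg_iff, le_div_iff₀ hp1]
    linarith
  rw [Real.rpow_neg_one] at h6
  calc r * w ^ (q - 1) ≤ r * ((A * (A * B) ^ (1 / (p - 1))) ^ (q - 1) * r⁻¹) := by
        gcongr
        exact h5.trans (by gcongr)
    _ = (A * (A * B) ^ (1 / (p - 1))) ^ (q - 1) := by field_simp

/-! ### Corrected Pohozaev function and the subcritical case -/

namespace IsRadialProfile

variable {n : ℕ} {p q M : ℝ} {u w : ℝ → ℝ}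

/-- Differentiating the correction `c * M * u * w ^ q` reproduces a multiple of the function itself,
which an integrating factor absorbs. The choice `c = (n + 1) / (n + 1 + q)` removes the term in `M *
u * w * w ^ (q - 1)`. Since then `0 < c < 1`, the `M ^ 2` term is nonnegative. -/
theorem hasDerivAt_pohozaev (h : IsRadialProfile n p q M u w) (hM : 0 < M) (c : ℝ) {r : ℝ}
    (hr : 0 < r) :
    HasDerivAt (fun r => r ^ (n + 1) * ((p + 1) * w r ^ 2 / 2 + u r ^ (p + 1) +
        c * M * (u r * w r ^ q)) - (n + 1) * (u r * (r ^ n * w r)))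
      (r ^ n * (((p + 1) - (n + 1) * (p - 1) / 2) * w r ^ 2 +
          (c * (n + 1 + q) - (n + 1)) * M * u r * w r * w r ^ (q - 1) +
          c * q * (1 - c) * M ^ 2 * r * u r * w r * (w r ^ (q - 1)) ^ 2 +
          ((p + 1) * (1 - c) + c * (2 * p - q * (p + 1)) / 2) * M * r * w r ^ 2 * w r ^ (q - 1)) +
        c * q * M * w r ^ (q - 1) * (r ^ (n + 1) * ((p + 1) * w r ^ 2 / 2 + u r ^ (p + 1) +
        c * M * (u r * w r ^ q)) - (n + 1) * (u r * (r ^ n * w r)))) r := by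
  have hw := h.w_pos hM hr
  have hu := h.u_pos r
  have dw := h.hasDerivAt_w' hM hr
  have du := h.hasDerivAt_u r
  have dflux := h.hasDerivAt_flux hr
  rw [abs_of_pos hw] at dflux
  have d1 := ((dw.pow 2).const_mul (p + 1)).div_const 2
  have d2 := du.rpow_const (p := p + 1) (Or.inl hu.ne')
  have d3 := (du.mul (dw.rpow_const (p := q) (Or.inl hw.ne'))).const_mul (c * M)
  have d4 := (du.mul dflux).const_mul ((n : ℝ) + 1)
  refine (((hasDerivAt_pow (n + 1) r).mul ((d1.add d2).add d3)).sub d4).congr_deriv ?_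
  have e1 : w r ^ q = w r ^ (q - 1) * w r := by
    rw [Real.rpow_sub_one hw.ne', div_mul_cancel₀ _ hw.ne']
  have e2 : u r ^ (p + 1) = u r ^ p * u r := by rw [Real.rpow_add_one hu.ne']
  simp only [Pi.add_apply, Pi.mul_apply, Pi.pow_apply, add_sub_cancel_right, e1, e2,
    Nat.add_sub_cancel, pow_succ r n]
  push_cast
  generalize w r ^ (q - 1) = a
  generalize u r ^ p = b
  field_simp
  ring

end IsRadialProfile

/-- A solution of `J' > g J` on `(0, ∞)` that starts from `0` is positive. -/
theorem pos_of_mul_lt_deriv {J J' g : ℝ → ℝ} (hJ : ContinuousOn J (Ici 0)) (h0 : J 0 = 0)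
    (hg : Continuous g) (hd : ∀ r, 0 < r → HasDerivAt J (J' r) r)
    (hlt : ∀ r, 0 < r → g r * J r < J' r) {r : ℝ} (hr : 0 < r) : 0 < J r := by
  have dG : ∀ s, HasDerivAt (fun r => ∫ t in (0 : ℝ)..r, g t) (g s) s := fun s =>
    (hg.integral_hasStrictDerivAt 0 s).hasDerivAt
  set G : ℝ → ℝ := fun r => ∫ t in (0 : ℝ)..r, g t
  have hdφ : ∀ s, 0 < s → HasDerivAt (fun r => J r * Real.exp (-G r))
      ((J' s - g s * J s) * Real.exp (-G s)) s := fun s hs => by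
    refine ((hd s hs).mul (dG s).neg.exp).congr_deriv ?_
    simp only [Pi.neg_apply]
    ring
  have hGc : Continuous G := continuous_iff_continuousAt.2 fun s => (dG s).continuousAt
  have hmono : StrictMonoOn (fun r => J r * Real.exp (-G r)) (Ici 0) := by
    refine strictMonoOn_of_deriv_pos (convex_Ici 0)
      (hJ.mul (by fun_prop : Continuous fun r => Real.exp (-G r)).continuousOn) fun s hs => ?_
    rw [interior_Ici] at hs
    rw [(hdφ s hs).deriv]
    exact mul_pos (sub_pos.2 (hlt s hs)) (Real.exp_pos _)
  have := hmono self_mem_Ici hr.le hr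
  simp only [h0, zero_mul] at this
  exact pos_of_mul_pos_left this (Real.exp_pos _).le

namespace IsRadialProfile

variable {n : ℕ} {p q M : ℝ} {u w : ℝ → ℝ}

theorem one_le_dim (h : IsRadialProfile n p q M u w) (hM : 0 < M) : 1 ≤ n := by
  have h1 := h.mul_rpow_le hM one_pos
  have h2 := Real.rpow_pos_of_pos (h.w_pos hM one_pos) (q - 1)
  have : (0 : ℝ) < n := lt_of_lt_of_le (by positivity) h1
  exact_mod_cast this

/-- `mul_w_le` with `u, w > 0` forces `n - 1 > 0`: there are no profiles in dimensions one and two.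
-/
theorem two_le_dim (h : IsRadialProfile n p q M u w) (hM : 0 < M) : 2 ≤ n := by
  have h1 := h.mul_w_le hM (h.one_le_dim hM) one_pos
  have h2 := h.w_pos hM one_pos
  have h3 : (0 : ℝ) < n - 1 := by
    by_contra! h4
    nlinarith [h.u_pos 1]
  have : (1 : ℝ) < n := by linarith
  exact_mod_cast this

theorem subcritical_contradiction (h : IsRadialProfile n p q M u w) (hM : 0 < M) (hp : 1 < p)
    (hq : 1 < q) (hd : 0 < (p + 1) - ((n : ℝ) + 1) * (p - 1) / 2)
    {c : ℝ} (hc : c * (n + 1 + q) = n + 1)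
    (hP : ∀ r, 0 < r → 0 < (p + 1) - ((n : ℝ) + 1) * (p - 1) / 2 +
      ((p + 1) * (1 - c) + c * (2 * p - q * (p + 1)) / 2) * (M * r * w r ^ (q - 1))) : False := by
  have hn2 := h.two_le_dim hM
  have hn2' : (2 : ℝ) ≤ n := by exact_mod_cast hn2
  have hc0 : 0 < c := by
    by_contra! hc0
    nlinarith
  have hc1 : c < 1 := by
    by_contra! hc1
    nlinarith
  set J : ℝ → ℝ := fun r => r ^ (n + 1) * ((p + 1) * w r ^ 2 / 2 + u r ^ (p + 1) +
        c * M * (u r * w r ^ q)) - (n + 1) * (u r * (r ^ n * w r)) with hJ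
  set J' : ℝ → ℝ := fun r => (r ^ n * (((p + 1) - (n + 1) * (p - 1) / 2) * w r ^ 2 +
          (c * (n + 1 + q) - (n + 1)) * M * u r * w r * w r ^ (q - 1) +
          c * q * (1 - c) * M ^ 2 * r * u r * w r * (w r ^ (q - 1)) ^ 2 +
          ((p + 1) * (1 - c) + c * (2 * p - q * (p + 1)) / 2) * M * r * w r ^ 2 * w r ^ (q - 1)) +
        c * q * M * w r ^ (q - 1) * J r) with hJ'
  have dJ : ∀ r, 0 < r → HasDerivAt J (J' r) r := fun r hr => h.hasDerivAt_pohozaev hM c hr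
  have hwc := h.continuous_w
  have huc := h.continuous_u
  have hg : Continuous fun r => c * q * M * w r ^ (q - 1) :=
    continuous_const.mul (hwc.rpow_const fun r => Or.inr (by linarith))
  have hJc : Continuous J := by
    have h1 : Continuous fun r => u r ^ (p + 1) := huc.rpow_const fun r => Or.inr (by linarith)
    have h2 : Continuous fun r => w r ^ q := hwc.rpow_const fun r => Or.inr (by linarith)
    fun_prop
  have hJ0 : J 0 = 0 := by simp [hJ, h.w_zero]
  have hlt : ∀ r, 0 < r → c * q * M * w r ^ (q - 1) * J r < J' r := by
    intro r hr
    have hw := h.w_pos hM hr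
    have hu := h.u_pos r
    have ha := Real.rpow_pos_of_pos hw (q - 1)
    rw [hJ']
    simp only [hc, sub_self, zero_mul, add_zero]
    have h1 := mul_pos (hP r hr) (pow_pos hw 2)
    have h2 : 0 ≤ c * q * (1 - c) * M ^ 2 * r * u r * w r * (w r ^ (q - 1)) ^ 2 := by
      have := sub_pos.2 hc1
      positivity
    have h3 : 0 < r ^ n * (((p + 1) - (n + 1) * (p - 1) / 2) * w r ^ 2 +
          c * q * (1 - c) * M ^ 2 * r * u r * w r * (w r ^ (q - 1)) ^ 2 +
          ((p + 1) * (1 - c) + c * (2 * p - q * (p + 1)) / 2) * M * r * w r ^ 2 *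
            w r ^ (q - 1)) := by
      refine mul_pos (pow_pos hr n) ?_
      nlinarith
    linarith
  have hJpos : ∀ r, 0 < r → 0 < J r := fun r hr =>
    pos_of_mul_lt_deriv hJc.continuousOn hJ0 hg dJ hlt hr
  have hJmono : MonotoneOn J (Ici 0) := by
    refine monotoneOn_of_deriv_nonneg (convex_Ici 0) hJc.continuousOn (fun s hs => ?_)
      fun s hs => ?_
    · rw [interior_Ici] at hs
      exact (dJ s hs).differentiableAt.differentiableWithinAt
    · rw [interior_Ici] at hs
      rw [(dJ s hs).deriv]
      refine le_trans ?_ (hlt s hs).le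
      have := h.w_pos hM hs
      have := hJpos s hs
      positivity
  set D : ℝ := (((n : ℝ) - 1) * (n + 1)) ^ (1 / (p - 1)) with hD
  set C : ℝ := (p + 1) * (n - 1) ^ 2 / 2 + (n + 1) * (n - 1) + c * n * (n - 1) with hC
  have hn1 : (0 : ℝ) ≤ n - 1 := by linarith
  -- The three positive terms of `J`, divided by `r ^ (n - 1)`, are each a constant times `u ^ 2`,
  -- and `C` adds these constants; the subtracted term is dropped. Then `u ≤ D * r ^ (-2 / (p -
  -- 1))`.
  have hbound : ∀ r, 0 < r → J r ≤ C * D ^ 2 * r ^ (n - 1 - 4 / (p - 1)) := by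
    intro r hr
    have hw := h.w_pos hM hr
    have hu := h.u_pos r
    have h1 := h.mul_w_le hM (by omega) hr
    have h2 := h.mul_rpow_le_mul_w hM hp hr
    have h3 := h.mul_rpow_le hM hr
    have h4 := rpow_decay_of_le hp (by positivity) hr hu h1 h2
    have e1 : w r ^ q = w r ^ (q - 1) * w r := by
      rw [Real.rpow_sub_one hw.ne', div_mul_cancel₀ _ hw.ne']
    have e2 : u r ^ (p + 1) = u r ^ p * u r := by rw [Real.rpow_add_one hu.ne']
    have f1 : r ^ 2 * ((p + 1) * w r ^ 2 / 2) ≤ (p + 1) * (n - 1) ^ 2 / 2 * u r ^ 2 := by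
      have : (r * w r) ^ 2 ≤ ((n - 1) * u r) ^ 2 := by gcongr
      nlinarith
    have f2 : r ^ 2 * (u r ^ (p + 1)) ≤ (n + 1) * (n - 1) * u r ^ 2 := by
      rw [e2]
      calc r ^ 2 * (u r ^ p * u r) = (r * u r ^ p) * (r * u r) := by ring
        _ ≤ ((n + 1) * w r) * (r * u r) := by gcongr
        _ = (n + 1) * (r * w r) * u r := by ring
        _ ≤ (n + 1) * ((n - 1) * u r) * u r := by gcongr
        _ = _ := by ring
    have f3 : r ^ 2 * (c * M * (u r * w r ^ q)) ≤ c * n * (n - 1) * u r ^ 2 := by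
      rw [e1]
      calc r ^ 2 * (c * M * (u r * (w r ^ (q - 1) * w r)))
          = c * (M * r * w r ^ (q - 1)) * (r * w r) * u r := by ring
        _ ≤ c * n * ((n - 1) * u r) * u r := by gcongr
        _ = _ := by ring
    have f4 : J r ≤ r ^ n / r * (C * u r ^ 2) := by
      have : J r = r ^ n / r * (r ^ 2 * ((p + 1) * w r ^ 2 / 2) + r ^ 2 * (u r ^ (p + 1)) +
          r ^ 2 * (c * M * (u r * w r ^ q))) - (n + 1) * (u r * (r ^ n * w r)) := by
        simp only [hJ]
        field_simp
        ring
      rw [this]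
      have h5 : 0 ≤ (n + 1) * (u r * (r ^ n * w r)) := by positivity
      have h6 : r ^ n / r * (r ^ 2 * ((p + 1) * w r ^ 2 / 2) + r ^ 2 * (u r ^ (p + 1)) +
          r ^ 2 * (c * M * (u r * w r ^ q))) ≤ r ^ n / r * (C * u r ^ 2) := by
        gcongr
        rw [hC]
        linarith
      linarith
    have hC0 : 0 ≤ C := by positivity
    calc J r ≤ r ^ n / r * (C * u r ^ 2) := f4
      _ ≤ r ^ n / r * (C * (D * r ^ (-(2 / (p - 1)))) ^ 2) := by gcongr
      _ = C * D ^ 2 * r ^ (n - 1 - 4 / (p - 1)) := by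
        have : r ^ (n - 1 - 4 / (p - 1)) = r ^ n / r * (r ^ (-(2 / (p - 1)))) ^ 2 := by
          rw [show (n : ℝ) - 1 - 4 / (p - 1) = n - 1 + -(2 / (p - 1)) * (2 : ℕ) by
            push_cast; ring, Real.rpow_add hr, Real.rpow_mul hr.le, Real.rpow_natCast,
            Real.rpow_sub_one hr.ne', Real.rpow_natCast]
        rw [this]
        ring
  -- This is `hd` rearranged: subcriticality makes the exponent negative.
  have hexp : (n : ℝ) - 1 - 4 / (p - 1) < 0 := by
    have hp1 : 0 < p - 1 := by linarith
    rw [sub_neg, lt_div_iff₀ hp1]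
    linarith
  have hlim : Tendsto (fun r : ℝ => C * D ^ 2 * r ^ (n - 1 - 4 / (p - 1))) atTop (𝓝 0) := by
    have := (tendsto_rpow_neg_atTop (neg_pos.2 hexp)).const_mul (C * D ^ 2)
    simpa using this
  obtain ⟨r, hr1, hr2⟩ := ((hlim.eventually_lt_const (hJpos 1 one_pos)).and
    (eventually_ge_atTop 1)).exists
  have h1 := hJmono (mem_Ici.2 zero_le_one) (mem_Ici.2 (by linarith)) hr2
  linarith [hbound r (by linarith)]

end IsRadialProfile

/-! ### Nonexistence theorems -/

theorem subcritical_pohozaev_pos {n : ℕ} {p : ℝ} (hn : 2 ≤ n)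
    (hps : p < (((n + 1 : ℕ) : ℝ) + 2) / (((n + 1 : ℕ) : ℝ) - 2)) :
    0 < (p + 1) - ((n : ℝ) + 1) * (p - 1) / 2 := by
  have hn' : (2 : ℝ) ≤ n := by exact_mod_cast hn
  push_cast at hps
  rw [lt_div_iff₀ (by linarith)] at hps
  linarith

theorem not_exists_radialGroundState_of_large {N : ℕ} {p q : ℝ} (hN : 1 ≤ N) (hp : 1 < p)
    (hq : 2 * p / (p + 1) < q) :
    ∃ M₀ : ℝ, 0 < M₀ ∧ ∀ M : ℝ, M₀ < M →
      ¬ ∃ u : EuclideanSpace ℝ (Fin N) → ℝ, IsRadialGroundState N p q M u ∧ u 0 = 1 := by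
  obtain ⟨n, rfl⟩ := Nat.exists_eq_add_of_le' hN
  have hq1 : 1 < q := by
    refine lt_trans ?_ hq
    rw [lt_div_iff₀ (by linarith)]
    linarith
  set κ : ℝ := ((1 / 2) ^ p / (n + 1)) ^ (q - 1) with hκ
  have hκ0 : 0 < κ := by positivity
  -- The profile bound reads `M * κ ≤ n`; using `n + 1` keeps the threshold positive even for `n =
  -- 0`.
  refine ⟨(n + 1) / κ, by positivity, ?_⟩
  rintro M hM ⟨u, hu, hu0⟩
  obtain ⟨U, w, hUw, hU0⟩ := hu.exists_radialProfile
  have hM0 : 0 < M := lt_trans (by positivity) hM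
  have := hUw.le_of_u_zero_eq_one hM0 hp hq1 (hU0.trans hu0)
  rw [div_lt_iff₀ hκ0] at hM
  linarith

theorem not_exists_radialGroundState_of_subcritical {N : ℕ} {p q : ℝ} (hN : 1 ≤ N) (hp : 1 < p)
    (hps : 3 ≤ N → p < ((N : ℝ) + 2) / ((N : ℝ) - 2)) (hq1 : 1 < q) (hqp : q ≤ p) {M : ℝ}
    (hM : 0 < M) :
    ¬ ∃ u : EuclideanSpace ℝ (Fin N) → ℝ, IsRadialGroundState N p q M u := by
  obtain ⟨n, rfl⟩ := Nat.exists_eq_add_of_le' hN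
  rintro ⟨u, hu⟩
  obtain ⟨U, w, h, -⟩ := hu.exists_radialProfile
  have hn := h.two_le_dim hM
  have hd := subcritical_pohozaev_pos hn (hps (by omega))
  have hn' : (2 : ℝ) ≤ n := by exact_mod_cast hn
  have hden : 0 < (n : ℝ) + 1 + q := by linarith
  have hc : (n + 1) / (n + 1 + q) * (n + 1 + q) = (n : ℝ) + 1 := div_mul_cancel₀ _ hden.ne'
  refine h.subcritical_contradiction hM hp hq1 hd hc fun r hr => ?_
  have hw := Real.rpow_pos_of_pos (h.w_pos hM hr) (q - 1)
  -- After clearing denominators, the claim is `q * (n - 1) * (p + 1) ≤ 2 * (n + 1) * p`. It follows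
  -- from `q ≤ p` and `(n - 1) * (p + 1) < 2 * (n + 1)`, the latter being subcriticality.
  have he : 0 ≤ (p + 1) * (1 - (n + 1) / (n + 1 + q)) +
      (n + 1) / (n + 1 + q) * (2 * p - q * (p + 1)) / 2 := by
    have : (p + 1) * (1 - (n + 1) / (n + 1 + q)) +
      (n + 1) / (n + 1 + q) * (2 * p - q * (p + 1)) / 2 =
        (2 * (n + 1) * p - q * (n - 1) * (p + 1)) / (2 * ((n : ℝ) + 1 + q)) := by
      field_simp
      ring
    rw [this]
    refine div_nonneg ?_ (by linarith)
    have h1 : q * ((n - 1) * (p + 1)) ≤ p * ((n - 1) * (p + 1)) :=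
      mul_le_mul_of_nonneg_right hqp (mul_nonneg (by linarith) (by linarith))
    nlinarith
  positivity

theorem not_exists_radialGroundState_of_small {N : ℕ} {p q : ℝ} (hN : 1 ≤ N) (hp : 1 < p)
    (hps : 3 ≤ N → p < ((N : ℝ) + 2) / ((N : ℝ) - 2)) (hpq : p < q) :
    ∃ M₀ : ℝ, 0 < M₀ ∧ ∀ M : ℝ, 0 < M → M < M₀ →
      ¬ ∃ u : EuclideanSpace ℝ (Fin N) → ℝ, IsRadialGroundState N p q M u ∧ u 0 = 1 := by
  obtain ⟨n, rfl⟩ := Nat.exists_eq_add_of_le' hN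
  by_cases hn : 2 ≤ n
  swap
  · refine ⟨1, one_pos, ?_⟩
    rintro M hM - ⟨u, hu, -⟩
    obtain ⟨U, w, h, -⟩ := hu.exists_radialProfile
    exact hn (h.two_le_dim hM)
  have hd := subcritical_pohozaev_pos hn (hps (by omega))
  have hn' : (2 : ℝ) ≤ n := by exact_mod_cast hn
  have hden : 0 < (n : ℝ) + 1 + q := by linarith
  have hc : (n + 1) / (n + 1 + q) * (n + 1 + q) = (n : ℝ) + 1 := div_mul_cancel₀ _ hden.ne'
  set d : ℝ := (p + 1) - ((n : ℝ) + 1) * (p - 1) / 2 with hd_def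
  set e : ℝ := (p + 1) * (1 - (n + 1) / (n + 1 + q)) +
      (n + 1) / (n + 1 + q) * (2 * p - q * (p + 1)) / 2 with he
  set A : ℝ := (((n : ℝ) - 1) * (((n : ℝ) - 1) * (n + 1)) ^ (1 / (p - 1))) ^ (q - 1) with hA
  have hn1 : (0 : ℝ) ≤ n - 1 := by linarith
  have hA0 : 0 ≤ A := by positivity
  -- Here `e` may be negative. Because `r * w ^ (q - 1) ≤ 1 + A`, this threshold keeps `d + e * (M *
  -- r * w ^ (q - 1))` positive; the `+ 1` after `|e|` avoids a zero denominator.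
  refine ⟨d / ((1 + A) * (|e| + 1)), by positivity, ?_⟩
  rintro M hM hMlt ⟨u, hu, hu0⟩
  obtain ⟨U, w, h, hU0⟩ := hu.exists_radialProfile
  have hq1 : 1 < q := hp.trans hpq
  refine h.subcritical_contradiction hM hp hq1 hd hc fun r hr => ?_
  have hw := h.w_pos hM hr
  have hV : r * w r ^ (q - 1) ≤ 1 + A := by
    rcases le_total r 1 with h1 | h1
    · have h2 : w r ≤ 1 := (h.w_le_self hM hp (hU0.trans hu0) hr.le).trans h1
      have h3 : w r ^ (q - 1) ≤ 1 := Real.rpow_le_one hw.le h2 (by linarith)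
      have h4 := Real.rpow_pos_of_pos hw (q - 1)
      nlinarith
    · have hq : 2 * p / (p + 1) ≤ q := by
        rw [div_le_iff₀ (by linarith)]
        nlinarith
      have := mul_rpow_bound_of_le hp hq hn1 (by positivity) h1 (h.u_pos r) hw
        (h.mul_w_le hM (by omega) hr) (h.mul_rpow_le_mul_w hM hp hr)
      linarith
  rw [lt_div_iff₀ (by positivity)] at hMlt
  have h1 : M * (r * w r ^ (q - 1)) * (|e| + 1) < d :=
    lt_of_le_of_lt (by rw [mul_assoc]; gcongr) hMlt
  have hwq := Real.rpow_pos_of_pos hw (q - 1)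
  have hMV : 0 < M * (r * w r ^ (q - 1)) := by positivity
  have h2 : -|e| ≤ e := neg_abs_le e
  change 0 < d + e * (M * r * w r ^ (q - 1))
  nlinarith

/-! ### Integral operator and global solvability for bounded Lipschitz data -/

theorem integral_const_mul_exp {l : ℝ} (hl : l ≠ 0) (D s : ℝ) :
    ∫ t in (0 : ℝ)..s, D * Real.exp (l * t) = D * (Real.exp (l * s) - 1) / l := by
  have hd : ∀ t ∈ uIcc 0 s, HasDerivAt (fun t => D * Real.exp (l * t) / l)
      (D * Real.exp (l * t)) t := fun t _ => by
    refine ((((hasDerivAt_id t).const_mul l).exp.const_mul D).div_const l).congr_deriv ?_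
    simp only [id]
    field_simp
  rw [intervalIntegral.integral_eq_sub_of_hasDerivAt hd
    (Continuous.intervalIntegrable (by fun_prop) _ _)]
  simp
  ring

/-- The averaged flux `∫₀¹ θ ^ n h (r θ) dθ = r ^ (-(n + 1)) ∫₀ʳ s ^ n h s ds`. -/
noncomputable def radialAverage (n : ℕ) (h : ℝ → ℝ) (r : ℝ) : ℝ :=
  ∫ θ in (0 : ℝ)..1, θ ^ n * h (r * θ)

theorem continuous_radialAverage (n : ℕ) {h : ℝ → ℝ} (hh : Continuous h) :
    Continuous (radialAverage n h) := by
  unfold radialAverage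
  exact intervalIntegral.continuous_parametric_intervalIntegral_of_continuous' (by fun_prop) 0 1

theorem radialAverage_zero (n : ℕ) (h : ℝ → ℝ) : (n + 1) * radialAverage n h 0 = h 0 := by
  simp only [radialAverage, zero_mul, intervalIntegral.integral_mul_const, integral_pow]
  simp
  field_simp

theorem pow_mul_radialAverage (n : ℕ) (h : ℝ → ℝ) (r : ℝ) :
    r ^ (n + 1) * radialAverage n h r = ∫ s in (0 : ℝ)..r, s ^ n * h s := by
  have := intervalIntegral.mul_integral_comp_mul_left (a := 0) (b := 1)
    (f := fun s => s ^ n * h s) r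
  simp only [mul_zero, mul_one] at this
  rw [← this, radialAverage, pow_succ', mul_assoc, ← intervalIntegral.integral_const_mul]
  congr 2
  ext θ
  ring

theorem hasDerivAt_radialAverage (n : ℕ) {h : ℝ → ℝ} (hh : Continuous h) {r : ℝ} (hr : 0 < r) :
    HasDerivAt (radialAverage n h) ((h r - (n + 1) * radialAverage n h r) / r) r := by
  have h1 : HasDerivAt (fun r => (∫ s in (0 : ℝ)..r, s ^ n * h s) / r ^ (n + 1))
      ((r ^ n * h r * r ^ (n + 1) - (∫ s in (0 : ℝ)..r, s ^ n * h s) *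
        ((n + 1 : ℕ) * r ^ n)) / (r ^ (n + 1)) ^ 2) r := by
    have hc : Continuous fun s => s ^ n * h s := by fun_prop
    exact (hc.integral_hasStrictDerivAt 0 r).hasDerivAt.div (hasDerivAt_pow (n + 1) r)
      (by positivity)
  refine (h1.congr_of_eventuallyEq ?_).congr_deriv ?_
  · filter_upwards [lt_mem_nhds hr] with s hs
    rw [← pow_mul_radialAverage]
    field_simp
  · rw [← pow_mul_radialAverage]
    push_cast
    field_simp
    ring

/-- The division by `l`, from integrating the exponential weight, is the gain that makes the
fixed-point map contract. -/
theorem abs_radialAverage_sub_le (n : ℕ) {h₁ h₂ : ℝ → ℝ} (hh₁ : Continuous h₁)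
    (hh₂ : Continuous h₂) {D l r : ℝ} (hl : 0 < l) (hr : 0 ≤ r) (hD : 0 ≤ D)
    (hb : ∀ s, 0 ≤ s → |h₁ s - h₂ s| ≤ D * Real.exp (l * s)) :
    r * |radialAverage n h₁ r - radialAverage n h₂ r| ≤ D * Real.exp (l * r) / l := by
  have h1 : r * |radialAverage n h₁ r - radialAverage n h₂ r| ≤
      r * ∫ θ in (0 : ℝ)..1, D * Real.exp (l * (r * θ)) := by
    refine mul_le_mul_of_nonneg_left ?_ hr
    rw [radialAverage, radialAverage, ← intervalIntegral.integral_sub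
      (Continuous.intervalIntegrable (by fun_prop) _ _)
      (Continuous.intervalIntegrable (by fun_prop) _ _), ← Real.norm_eq_abs]
    refine intervalIntegral.norm_integral_le_of_norm_le zero_le_one ?_
      (Continuous.intervalIntegrable (by fun_prop) _ _)
    refine Eventually.of_forall fun θ hθ => ?_
    rw [← mul_sub, norm_mul, Real.norm_eq_abs, Real.norm_eq_abs, abs_of_nonneg (pow_nonneg hθ.1.le n)]
    calc θ ^ n * |h₁ (r * θ) - h₂ (r * θ)| ≤ 1 * |h₁ (r * θ) - h₂ (r * θ)| := by
          gcongr
          exact pow_le_one₀ hθ.1.le hθ.2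
      _ ≤ _ := by
          rw [one_mul]
          exact hb _ (mul_nonneg hr hθ.1.le)
  refine h1.trans ?_
  have := intervalIntegral.mul_integral_comp_mul_left (a := 0) (b := 1)
    (f := fun s => D * Real.exp (l * s)) r
  rw [this, mul_zero, mul_one, integral_const_mul_exp hl.ne']
  gcongr
  linarith

theorem abs_radialAverage_le (n : ℕ) {h : ℝ → ℝ} {B : ℝ} (hb : ∀ s, |h s| ≤ B) (r : ℝ) :
    |radialAverage n h r| ≤ B := by
  have hB : 0 ≤ B := (abs_nonneg _).trans (hb 0)
  have := intervalIntegral.norm_integral_le_of_norm_le_const (a := 0) (b := 1) (C := B)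
    (f := fun θ => θ ^ n * h (r * θ)) fun θ hθ => ?_
  · simpa [radialAverage] using this
  · rw [uIoc_of_le zero_le_one] at hθ
    rw [norm_mul, Real.norm_eq_abs, Real.norm_eq_abs, abs_of_nonneg (pow_nonneg hθ.1.le n)]
    calc θ ^ n * |h (r * θ)| ≤ 1 * B := by
          gcongr
          · exact pow_le_one₀ hθ.1.le hθ.2
          · exact hb _
      _ = B := one_mul B

/-- Global solvability of the integrated radial initial value problem with a bounded Lipschitz
right-hand side, by contraction in an exponentially weighted space. -/
theorem exists_global_radial_solution (n : ℕ) {Φ : ℝ → ℝ → ℝ} {L B : ℝ} (hL : 0 ≤ L)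
    (hΦ : ∀ a b a' b', |Φ a b - Φ a' b'| ≤ L * (|a - a'| + |b - b'|))
    (hB : ∀ a b, |Φ a b| ≤ B) :
    ∃ u w : ℝ → ℝ, Continuous w ∧ u 0 = 1 ∧ (∀ r, HasDerivAt u (-w r) r) ∧
      ∀ r, 0 ≤ r → w r = r * radialAverage n (fun s => Φ (u s) (w s)) r := by
  have hB0 : 0 ≤ B := (abs_nonneg _).trans (hB 0 0)
  have hΦc : Continuous fun x : ℝ × ℝ => Φ x.1 x.2 := by
    rw [continuous_iff_continuousAt]
    intro x
    rw [ContinuousAt, tendsto_iff_dist_tendsto_zero]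
    have h1 : Continuous fun y : ℝ × ℝ => L * (|y.1 - x.1| + |y.2 - x.2|) := by fun_prop
    have h2 := h1.tendsto x
    simp only [sub_self, abs_zero, add_zero, mul_zero] at h2
    exact squeeze_zero (fun _ => dist_nonneg) (fun y => hΦ _ _ _ _) h2
  -- With `l ≥ 1`, integrating `w` does not enlarge the weighted distance. With `l ≥ 4 * L`, the
  -- resulting Lipschitz constant `2 * L / l` is at most `1 / 2`.
  set l : ℝ := 4 * L + 4 with hl_def
  have hl : 0 < l := by positivity
  -- The unknown is `v = exp (-l * s) * w`, so its sup norm is the weighted norm of `w`.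
  let W : (ℝ →ᵇ ℝ) → ℝ → ℝ := fun v s => Real.exp (l * s) * v s
  have hW : ∀ v, Continuous (W v) := fun v => by
    have := v.continuous
    fun_prop
  let U : (ℝ →ᵇ ℝ) → ℝ → ℝ := fun v s => 1 - ∫ t in (0 : ℝ)..s, W v t
  have hUd : ∀ v r, HasDerivAt (U v) (-W v r) r := fun v r =>
    ((hW v).integral_hasStrictDerivAt 0 r).hasDerivAt.const_sub 1
  have hU : ∀ v, Continuous (U v) := fun v =>
    continuous_iff_continuousAt.2 fun r => (hUd v r).continuousAt
  let H : (ℝ →ᵇ ℝ) → ℝ → ℝ := fun v s => Φ (U v s) (W v s)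
  have hH : ∀ v, Continuous (H v) := fun v => hΦc.comp ((hU v).prodMk (hW v))
  -- Only `r ≥ 0` matters. Freezing the map at `max r 0` keeps it bounded and continuous on the
  -- whole line.
  let S : (ℝ →ᵇ ℝ) → ℝ → ℝ := fun v r =>
    Real.exp (-(l * max r 0)) * (max r 0 * radialAverage n (H v) (max r 0))
  have hS : ∀ v, Continuous (S v) := fun v => by
    have := continuous_radialAverage n (hH v)
    fun_prop
  have hSb : ∀ v r, ‖S v r‖ ≤ B := fun v r => by
    have h1 := abs_radialAverage_le n (h := H v) (fun s => hB _ _) (max r 0)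
    have h2 : 0 ≤ max r 0 := le_max_right _ _
    have h3 : Real.exp (-(l * max r 0)) * max r 0 ≤ 1 := by
      rw [Real.exp_neg, inv_mul_le_iff₀ (Real.exp_pos _), mul_one]
      nlinarith [Real.add_one_le_exp (l * max r 0)]
    rw [Real.norm_eq_abs]
    simp only [S]
    rw [← mul_assoc, abs_mul, abs_of_nonneg (by positivity)]
    calc _ ≤ 1 * B := by gcongr
      _ = B := one_mul B
  let T : (ℝ →ᵇ ℝ) → (ℝ →ᵇ ℝ) := fun v => BoundedContinuousFunction.ofNormedAddCommGroup (S v) (hS v) B (hSb v)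
  have hT : ContractingWith (1 / 2 : ℝ≥0) T := by
    refine ⟨by rw [← NNReal.coe_lt_coe]; norm_num, LipschitzWith.of_dist_le_mul fun v₁ v₂ => ?_⟩
    set D := dist v₁ v₂ with hD
    have hD0 : 0 ≤ D := dist_nonneg
    have hWd : ∀ s, |W v₁ s - W v₂ s| ≤ D * Real.exp (l * s) := fun s => by
      simp only [W]
      rw [← mul_sub, abs_mul, Real.abs_exp, mul_comm]
      gcongr
      rw [← Real.dist_eq]
      exact BoundedContinuousFunction.dist_coe_le_dist s
    have hUd' : ∀ s, 0 ≤ s → |U v₁ s - U v₂ s| ≤ D * Real.exp (l * s) := fun s hs => by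
      simp only [U]
      rw [sub_sub_sub_cancel_left, abs_sub_comm, ← intervalIntegral.integral_sub
        ((hW v₁).intervalIntegrable _ _) ((hW v₂).intervalIntegrable _ _), ← Real.norm_eq_abs]
      refine (intervalIntegral.norm_integral_le_of_norm_le hs
        (Eventually.of_forall fun t _ => hWd t)
        (Continuous.intervalIntegrable (by fun_prop) _ _)).trans ?_
      rw [integral_const_mul_exp hl.ne', div_le_iff₀ hl]
      have h1 : 1 ≤ l := by rw [hl_def]; linarith
      have h2 := mul_nonneg hD0 (Real.exp_pos (l * s)).le
      nlinarith
    have hHd : ∀ s, 0 ≤ s → |H v₁ s - H v₂ s| ≤ (2 * L * D) * Real.exp (l * s) := fun s hs => by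
      refine (hΦ _ _ _ _).trans ?_
      have := mul_le_mul_of_nonneg_left (add_le_add (hUd' s hs) (hWd s)) hL
      linarith
    rw [BoundedContinuousFunction.dist_le (by positivity)]
    intro r
    have h2 : 0 ≤ max r 0 := le_max_right _ _
    have h1 := abs_radialAverage_sub_le n (hH v₁) (hH v₂) hl h2 (by positivity) hHd
    change |S v₁ r - S v₂ r| ≤ _
    simp only [S]
    rw [← mul_sub, ← mul_sub, abs_mul, abs_mul, Real.abs_exp, abs_of_nonneg h2, Real.exp_neg,
      inv_mul_le_iff₀ (Real.exp_pos _)]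
    refine h1.trans ?_
    rw [div_le_iff₀ hl]
    have h3 := mul_nonneg hD0 (Real.exp_pos (l * max r 0)).le
    push_cast
    nlinarith
  have hfix : T (hT.fixedPoint T) = hT.fixedPoint T := hT.fixedPoint_isFixedPt
  set v := hT.fixedPoint T
  refine ⟨U v, W v, hW v, by simp [U], hUd v, fun r hr => ?_⟩
  have h1 : S v r = v r := congrArg (fun f : ℝ →ᵇ ℝ => f r) hfix
  simp only [S, max_eq_left hr] at h1
  change Real.exp (l * r) * v r = _
  rw [← h1, ← mul_assoc, ← Real.exp_add]
  simp [H]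

/-! ### Truncated problem -/

/-- The power `x ^ s` frozen outside `[0, b]`. -/
noncomputable def clampedPow (s b x : ℝ) : ℝ := max 0 (min x b) ^ s

theorem clampedPow_nonneg (s b x : ℝ) : 0 ≤ clampedPow s b x :=
  Real.rpow_nonneg (le_max_left _ _) s

theorem clampedPow_le {s b : ℝ} (hs : 0 ≤ s) (hb : 0 ≤ b) (x : ℝ) : clampedPow s b x ≤ b ^ s :=
  Real.rpow_le_rpow (le_max_left _ _) (max_le hb (min_le_right _ _)) hs

theorem clampedPow_mono {s b : ℝ} (hs : 0 ≤ s) : Monotone (clampedPow s b) := fun _ _ hxy =>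
  Real.rpow_le_rpow (le_max_left _ _) (max_le_max_left _ (min_le_min_right _ hxy)) hs

theorem clampedPow_le_rpow {s b x : ℝ} (hs : 0 ≤ s) (hx : 0 ≤ x) : clampedPow s b x ≤ x ^ s :=
  Real.rpow_le_rpow (le_max_left _ _) (max_le hx (min_le_left _ _)) hs

theorem clampedPow_of_le {s b x : ℝ} (hx : x ≤ b) : clampedPow s b x = max x 0 ^ s := by
  rw [clampedPow, min_eq_left hx, max_comm]

theorem clampedPow_of_mem {s b x : ℝ} (h0 : 0 ≤ x) (hx : x ≤ b) : clampedPow s b x = x ^ s := by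
  rw [clampedPow_of_le hx, max_eq_left h0]

theorem abs_clampedPow_sub_le {s b : ℝ} (hs : 1 ≤ s) (hb : 0 ≤ b) (x y : ℝ) :
    |clampedPow s b x - clampedPow s b y| ≤ s * b ^ (s - 1) * |x - y| := by
  have hmem : ∀ x, max 0 (min x b) ∈ Icc 0 b := fun x =>
    ⟨le_max_left _ _, max_le hb (min_le_right _ _)⟩
  have h1 := (convex_Icc 0 b).norm_image_sub_le_of_norm_hasDerivWithin_le
    (f := fun x => x ^ s) (f' := fun x => s * x ^ (s - 1)) (C := s * b ^ (s - 1))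
    (fun x _ => (Real.hasDerivAt_rpow_const (Or.inr hs)).hasDerivWithinAt)
    (fun x hx => by
      rw [Real.norm_eq_abs, abs_of_nonneg (mul_nonneg (by linarith) (Real.rpow_nonneg hx.1 _))]
      exact mul_le_mul_of_nonneg_left (Real.rpow_le_rpow hx.1 hx.2 (by linarith)) (by linarith))
    (hmem y) (hmem x)
  refine h1.trans (mul_le_mul_of_nonneg_left ?_ (mul_nonneg (by linarith) (Real.rpow_nonneg hb _)))
  rw [Real.norm_eq_abs]
  calc |max 0 (min x b) - max 0 (min y b)| ≤ max |0 - 0| |min x b - min y b| :=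
        abs_max_sub_max_le_max _ _ _ _
    _ = |min x b - min y b| := by simp
    _ ≤ max |x - y| |b - b| := abs_min_sub_min_le_max _ _ _ _
    _ = |x - y| := by simp

/-- Needed to differentiate the Pohozaev function before `u` is known to be positive. -/
theorem hasDerivAt_max_zero_rpow {p : ℝ} (hp : 0 < p) (x : ℝ) :
    HasDerivAt (fun x : ℝ => max x 0 ^ (p + 1)) ((p + 1) * max x 0 ^ p) x := by
  rcases lt_trichotomy x 0 with hx | rfl | hx
  · rw [max_eq_right hx.le, Real.zero_rpow hp.ne', mul_zero]
    refine (hasDerivAt_const x (0 : ℝ)).congr_of_eventuallyEq ?_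
    filter_upwards [gt_mem_nhds hx] with y hy
    rw [max_eq_right hy.le, Real.zero_rpow (by linarith)]
  · rw [hasDerivAt_iff_isLittleO_nhds_zero]
    have h1 : (fun y : ℝ => max y 0 ^ p) =o[𝓝 0] fun _ => (1 : ℝ) := by
      rw [Asymptotics.isLittleO_one_iff]
      have hc : Continuous fun y : ℝ => max y 0 ^ p :=
        (continuous_id.max continuous_const).rpow_const fun _ => Or.inr hp.le
      simpa [Real.zero_rpow hp.ne'] using hc.tendsto 0
    have h2 : (fun y : ℝ => max y 0) =O[𝓝 0] fun y => y := by
      refine Asymptotics.IsBigO.of_bound 1 (Eventually.of_forall fun y => ?_)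
      rw [one_mul, Real.norm_eq_abs, Real.norm_eq_abs, abs_of_nonneg (le_max_right _ _)]
      exact max_le (le_abs_self y) (abs_nonneg y)
    have h3 := h1.mul_isBigO h2
    simp only [one_mul] at h3
    refine h3.congr_left fun y => ?_
    rw [← Real.rpow_add_one' (le_max_right _ _) (by linarith)]
    simp [Real.zero_rpow hp.ne', Real.zero_rpow (by linarith : p + 1 ≠ 0)]
  · rw [max_eq_left hx.le]
    have := Real.hasDerivAt_rpow_const (x := x) (p := p + 1) (Or.inl hx.ne')
    rw [add_sub_cancel_right] at this
    refine this.congr_of_eventuallyEq ?_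
    filter_upwards [lt_mem_nhds hx] with y hy
    rw [max_eq_left hy.le]

theorem le_radialAverage (n : ℕ) {h : ℝ → ℝ} (hh : Continuous h) {m r : ℝ} (hr : 0 ≤ r)
    (hm : ∀ s, 0 ≤ s → s ≤ r → m ≤ h s) : m ≤ (n + 1) * radialAverage n h r := by
  have h1 : ∫ θ in (0 : ℝ)..1, θ ^ n * m ≤ radialAverage n h r := by
    refine intervalIntegral.integral_mono_on zero_le_one
      (Continuous.intervalIntegrable (by fun_prop) _ _)
      (Continuous.intervalIntegrable (by fun_prop) _ _) fun θ hθ => ?_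
    have := hm (r * θ) (mul_nonneg hr hθ.1) (mul_le_of_le_one_right hr hθ.2)
    have := pow_nonneg hθ.1 n
    gcongr
  rw [intervalIntegral.integral_mul_const, integral_pow] at h1
  simp only [one_pow, zero_pow n.succ_ne_zero, sub_zero] at h1
  rw [one_div_mul_eq_div, div_le_iff₀ (by positivity)] at h1
  linarith

/-- A solution of the integrated radial initial value problem in which `u ^ p` and `w ^ q` are
frozen outside `[0, 1]` and `[0, b]`. -/
structure IsClampedProfile (n : ℕ) (p q M b : ℝ) (u w K h : ℝ → ℝ) : Prop where
  u_zero : u 0 = 1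
  continuous_w : Continuous w
  continuous_K : Continuous K
  continuous_h : Continuous h
  h_eq : ∀ r, h r = clampedPow p 1 (u r) + M * clampedPow q b (w r)
  w_eq : ∀ r, 0 ≤ r → w r = r * K r
  K_zero : (n + 1) * K 0 = h 0
  K_nonneg : ∀ r, 0 ≤ r → 0 ≤ K r
  K_le : ∀ r, K r ≤ 2
  hasDerivAt_u : ∀ r, HasDerivAt u (-w r) r
  hasDerivAt_K : ∀ r, 0 < r → HasDerivAt K ((h r - (n + 1) * K r) / r) r
  le_one : ∀ r, 0 ≤ r → u r ≤ 1
  mul_clampedPow_le : ∀ r, 0 ≤ r → r * clampedPow p 1 (u r) ≤ (n + 1) * w r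

theorem exists_isClampedProfile (n : ℕ) {p q M b : ℝ} (hp : 1 < p) (hq1 : 1 < q) (hM : 0 < M)
    (hb0 : 0 < b) (hM1 : M * b ^ q ≤ 1) :
    ∃ u w K h : ℝ → ℝ, IsClampedProfile n p q M b u w K h := by
  obtain ⟨u, w, hwc, hu0, hud, hwK⟩ := exists_global_radial_solution n
    -- `L` adds the Lipschitz constants of the two truncated powers. `B = 2` because the first power
    -- is at most `1` and `M * b ^ q ≤ 1`.
    (Φ := fun x y => clampedPow p 1 x + M * clampedPow q b y)
    (L := p * 1 ^ (p - 1) + M * (q * b ^ (q - 1))) (B := 2) (by positivity)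
    (fun x y x' y' => by
      have h1 := abs_clampedPow_sub_le hp.le zero_le_one x x'
      have h2 := mul_le_mul_of_nonneg_left (abs_clampedPow_sub_le hq1.le hb0.le y y') hM.le
      have h3 : |clampedPow p 1 x + M * clampedPow q b y -
          (clampedPow p 1 x' + M * clampedPow q b y')| ≤
          |clampedPow p 1 x - clampedPow p 1 x'| + M * |clampedPow q b y - clampedPow q b y'| := by
        rw [show clampedPow p 1 x + M * clampedPow q b y -
          (clampedPow p 1 x' + M * clampedPow q b y') =
          (clampedPow p 1 x - clampedPow p 1 x') + M * (clampedPow q b y - clampedPow q b y') by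
            ring]
        refine (abs_add_le _ _).trans ?_
        rw [abs_mul, abs_of_pos hM]
      have h4 : 0 ≤ p * 1 ^ (p - 1) * |y - y'| := by positivity
      have h5 : 0 ≤ M * (q * b ^ (q - 1)) * |x - x'| := by positivity
      linarith)
    (fun x y => by
      have h1 := clampedPow_nonneg p 1 x
      have h2 := clampedPow_nonneg q b y
      have h3 := clampedPow_le (s := p) (by linarith) zero_le_one x
      have h4 := clampedPow_le (s := q) (by linarith) hb0.le y
      rw [Real.one_rpow] at h3
      rw [abs_of_nonneg (by positivity)]
      nlinarith)
  have huc : Continuous u := continuous_iff_continuousAt.2 fun r => (hud r).continuousAt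
  have hcl : ∀ {s c : ℝ}, 0 ≤ s → Continuous (clampedPow s c) := fun hs =>
    (continuous_const.max (continuous_id.min continuous_const)).rpow_const fun _ => Or.inr hs
  set h : ℝ → ℝ := fun s => clampedPow p 1 (u s) + M * clampedPow q b (w s) with hh_def
  have hh : Continuous h :=
    ((hcl (by linarith)).comp huc).add (continuous_const.mul ((hcl (by linarith)).comp hwc))
  set K : ℝ → ℝ := radialAverage n h with hK_def
  have hKc : Continuous K := continuous_radialAverage n hh
  have hKd : ∀ r, 0 < r → HasDerivAt K ((h r - (n + 1) * K r) / r) r := fun r hr =>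
    hasDerivAt_radialAverage n hh hr
  have hh0 : ∀ r, 0 ≤ h r := fun r => by
    have h1 := clampedPow_nonneg p 1 (u r)
    have h2 := clampedPow_nonneg q b (w r)
    positivity
  have hK0 : ∀ r, 0 ≤ r → 0 ≤ K r := fun r hr => by
    have := le_radialAverage n hh hr fun s _ _ => hh0 s
    exact nonneg_of_mul_nonneg_right this (by positivity)
  have hw0 : ∀ r, 0 ≤ r → 0 ≤ w r := fun r hr => by
    rw [hwK r hr]
    exact mul_nonneg hr (hK0 r hr)
  have huanti : AntitoneOn u (Ici 0) := by
    refine antitoneOn_of_deriv_nonpos (convex_Ici 0) huc.continuousOn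
      (fun s _ => (hud s).differentiableAt.differentiableWithinAt) fun s hs => ?_
    rw [interior_Ici] at hs
    rw [(hud s).deriv, neg_nonpos]
    exact hw0 s (le_of_lt hs)
  have hu1 : ∀ r, 0 ≤ r → u r ≤ 1 := fun r hr => hu0 ▸ huanti self_mem_Ici hr hr
  have hK2 : ∀ r, K r ≤ 2 := fun r =>
    (le_abs_self _).trans (abs_radialAverage_le n (fun s => by
      have h1 := clampedPow_nonneg p 1 (u s)
      have h2 := clampedPow_nonneg q b (w s)
      have h3 := clampedPow_le (s := p) (by linarith) zero_le_one (u s)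
      have h4 := clampedPow_le (s := q) (by linarith) hb0.le (w s)
      rw [Real.one_rpow] at h3
      rw [abs_of_nonneg (hh0 s), hh_def]
      nlinarith) r)
  have hY : ∀ r, 0 ≤ r → r * clampedPow p 1 (u r) ≤ (n + 1) * w r := fun r hr => by
    have := le_radialAverage n hh hr (m := clampedPow p 1 (u r)) fun s hs hsr => by
      have h1 := clampedPow_mono (b := 1) (by linarith : 0 ≤ p) (huanti hs hr hsr)
      have h2 := clampedPow_nonneg q b (w s)
      have := mul_nonneg hM.le h2
      simp only [hh_def]
      linarith
    rw [hwK r hr]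
    calc r * clampedPow p 1 (u r) ≤ r * ((n + 1) * K r) := by gcongr
      _ = _ := by ring
  exact ⟨u, w, K, h, hu0, hwc, hKc, hh, fun _ => rfl, hwK, radialAverage_zero n h, hK0, hK2, hud,
    hKd, hu1, hY⟩

namespace IsClampedProfile

variable {n : ℕ} {p q M b : ℝ} {u w K h : ℝ → ℝ}

theorem continuous_u (hc : IsClampedProfile n p q M b u w K h) : Continuous u :=
  continuous_iff_continuousAt.2 fun r => (hc.hasDerivAt_u r).continuousAt

theorem w_nonneg (hc : IsClampedProfile n p q M b u w K h) {r : ℝ} (hr : 0 ≤ r) : 0 ≤ w r := by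
  rw [hc.w_eq r hr]
  exact mul_nonneg hr (hc.K_nonneg r hr)

theorem hasDerivAt_w (hc : IsClampedProfile n p q M b u w K h) {r : ℝ} (hr : 0 < r) :
    HasDerivAt w (h r - n * w r / r) r := by
  have h1 := (hasDerivAt_id r).mul (hc.hasDerivAt_K r hr)
  refine (h1.congr_of_eventuallyEq ?_).congr_deriv ?_
  · filter_upwards [lt_mem_nhds hr] with s hs using hc.w_eq s hs.le
  · rw [hc.w_eq r hr.le]
    simp only [id]
    field_simp
    ring

end IsClampedProfile

/-! ### Pohozaev barrier in the supercritical case -/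

/-- The Pohozaev function of a radial pair `(u, w)`. -/
noncomputable def pohozaev (n : ℕ) (p : ℝ) (u w : ℝ → ℝ) (r : ℝ) : ℝ :=
  r ^ (n + 1) * ((p + 1) * w r ^ 2 / 2 + max (u r) 0 ^ (p + 1)) -
    (n + 1) * (r ^ n * (u r * w r))

namespace IsClampedProfile

variable {n : ℕ} {p q M b : ℝ} {u w K h : ℝ → ℝ}

theorem continuous_pohozaev (hc : IsClampedProfile n p q M b u w K h) (hp : 1 < p) :
    Continuous (pohozaev n p u w) := by
  have huc := hc.continuous_u
  have hwc := hc.continuous_w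
  have h1 : Continuous fun r => max (u r) 0 ^ (p + 1) :=
    (huc.max continuous_const).rpow_const fun _ => Or.inr (by linarith)
  unfold pohozaev
  fun_prop

theorem hasDerivAt_pohozaev (hc : IsClampedProfile n p q M b u w K h) (hp : 1 < p) {r : ℝ}
    (hr : 0 < r) :
    HasDerivAt (pohozaev n p u w) (r ^ n * (-((n + 1) * (p - 1) / 2 - (p + 1)) * w r ^ 2 +
      M * clampedPow q b (w r) * ((p + 1) * r * w r - (n + 1) * u r))) r := by
  have d1 := (((hc.hasDerivAt_w hr).pow 2).const_mul (p + 1)).div_const 2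
  have d2 := (hasDerivAt_max_zero_rpow (by linarith : 0 < p) (u r)).comp r (hc.hasDerivAt_u r)
  have d3 := ((hasDerivAt_pow n r).mul ((hc.hasDerivAt_u r).mul (hc.hasDerivAt_w hr))).const_mul ((n : ℝ) + 1)
  refine (((hasDerivAt_pow (n + 1) r).mul (d1.add d2)).sub d3).congr_deriv ?_
  have e1 : max (u r) 0 ^ (p + 1) = max (u r) 0 ^ p * u r := by
    rcases le_total (u r) 0 with h1 | h1
    · rw [max_eq_right h1, Real.zero_rpow (by linarith), Real.zero_rpow (by linarith), zero_mul]
    · rw [max_eq_left h1, Real.rpow_add_one' h1 (by linarith)]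
  have e2 : (n : ℝ) * r ^ (n - 1) = n * r ^ n / r := by
    rcases n with _ | m
    · simp
    · rw [Nat.add_sub_cancel, pow_succ]
      field_simp
  simp only [Pi.add_apply, Pi.mul_apply, Pi.pow_apply, Function.comp_apply, e1, e2,
    hc.h_eq, clampedPow_of_le (hc.le_one r hr.le), Nat.add_sub_cancel, pow_succ r n]
  generalize max (u r) 0 ^ p = a
  generalize clampedPow q b (w r) = g
  push_cast
  field_simp
  ring

/-- Negativity makes the only subtracted term, a multiple of `u * w`, dominate the nonnegative ones.
Thus `u * w > 0`, and comparing it with `(p + 1) / 2 * r * w ^ 2 ≥ r * w ^ 2` gives the last bound.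
-/
theorem bounds_of_pohozaev_neg (hc : IsClampedProfile n p q M b u w K h) (hp : 1 < p) {r : ℝ}
    (hr : 0 < r) (hJr : pohozaev n p u w r < 0) :
    0 < u r ∧ 0 < w r ∧ r * w r ≤ (n + 1) * u r := by
  have hw := hc.w_nonneg hr.le
  have hrn := pow_pos hr n
  have hup : 0 ≤ max (u r) 0 ^ (p + 1) := Real.rpow_nonneg (le_max_right _ _) _
  have h1 : r * ((p + 1) * w r ^ 2 / 2 + max (u r) 0 ^ (p + 1)) < (n + 1) * (u r * w r) := by
    have : r ^ n * (r * ((p + 1) * w r ^ 2 / 2 + max (u r) 0 ^ (p + 1)) -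
        (n + 1) * (u r * w r)) < 0 := by
      have e : pohozaev n p u w r = r ^ n * (r * ((p + 1) * w r ^ 2 / 2 + max (u r) 0 ^ (p + 1)) -
        (n + 1) * (u r * w r)) := by
        simp only [pohozaev]
        ring
      rwa [← e]
    exact sub_neg.1 ((pos_iff_neg_of_mul_neg this).1 hrn)
  have h2 : 0 < (n + 1) * (u r * w r) := lt_of_le_of_lt (by positivity) h1
  have h3 : 0 < u r * w r := pos_of_mul_pos_right h2 (by positivity)
  have hw' : 0 < w r := lt_of_le_of_ne hw fun h => by simp [← h] at h3
  refine ⟨pos_of_mul_pos_left h3 hw, hw', ?_⟩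
  have h4 : r * w r * w r ≤ (n + 1) * u r * w r := by
    have h5 : r * w r ^ 2 ≤ r * ((p + 1) * w r ^ 2 / 2) := by
      gcongr
      nlinarith [sq_nonneg (w r)]
    have h6 := mul_nonneg hr.le hup
    nlinarith
  exact le_of_mul_le_mul_right h4 hw'

/-- The bounds available where the function is negative give `r * w ^ (q - 1) ≤ C`. The gradient
contribution is then at most `M * (p + 1) * C * w ^ 2`, which `d * w ^ 2` beats. The two summands of
`C` cover `r ≤ 1`, where `w ≤ 2`, and `r ≥ 1`, where decay applies. -/
theorem deriv_pohozaev_neg (hc : IsClampedProfile n p q M b u w K h) (hp : 1 < p) (hq1 : 1 < q)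
    (hq : 2 * p / (p + 1) ≤ q) (hM : 0 < M) {d C : ℝ}
    (hC : 2 ^ (q - 1) + (((n : ℝ) + 1) * (((n : ℝ) + 1) * (n + 1)) ^ (1 / (p - 1))) ^ (q - 1) ≤ C)
    (hM2 : M * ((p + 1) * C) < d) {r : ℝ} (hr : 0 < r) (hJr : pohozaev n p u w r < 0) :
    r ^ n * (-d * w r ^ 2 +
      M * clampedPow q b (w r) * ((p + 1) * r * w r - (n + 1) * u r)) < 0 := by
  obtain ⟨hu, hw, hX⟩ := hc.bounds_of_pohozaev_neg hp hr hJr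
  have hg := clampedPow_nonneg q b (w r)
  refine mul_neg_of_pos_of_neg (pow_pos hr n) ?_
  have hgw : clampedPow q b (w r) ≤ w r ^ (q - 1) * w r := by
    rw [Real.rpow_sub_one hw.ne', div_mul_cancel₀ _ hw.ne']
    exact clampedPow_le_rpow (by linarith) hw.le
  have hV : r * w r ^ (q - 1) ≤ C := by
    rcases le_total r 1 with h1 | h1
    · have h2 : w r ≤ 2 := by
        rw [hc.w_eq r hr.le]
        calc r * K r ≤ 1 * 2 := by
              gcongr
              · exact hc.K_nonneg r hr.le
              · exact hc.K_le r
          _ = 2 := by norm_num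
      have h3 : w r ^ (q - 1) ≤ 2 ^ (q - 1) := Real.rpow_le_rpow hw.le h2 (by linarith)
      have h4 := Real.rpow_pos_of_pos hw (q - 1)
      have hA0 : 0 ≤ (((n : ℝ) + 1) * (((n : ℝ) + 1) * (n + 1)) ^ (1 / (p - 1))) ^ (q - 1) := by
        positivity
      nlinarith
    · have h2 := hc.mul_clampedPow_le r hr.le
      rw [clampedPow_of_mem hu.le (hc.le_one r hr.le)] at h2
      have h3 := mul_rpow_bound_of_le hp hq (by positivity : (0 : ℝ) ≤ n + 1)
        (by positivity : (0 : ℝ) ≤ n + 1) h1 hu hw hX h2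
      have : (0 : ℝ) ≤ 2 ^ (q - 1) := by positivity
      linarith
  have h1 : M * clampedPow q b (w r) * ((p + 1) * r * w r - (n + 1) * u r) ≤
      M * clampedPow q b (w r) * ((p + 1) * r * w r) := by
    gcongr
    have : 0 ≤ (n + 1) * u r := by positivity
    linarith
  have h2 : M * clampedPow q b (w r) * ((p + 1) * r * w r) ≤ M * ((p + 1) * C) * w r ^ 2 := by
    calc M * clampedPow q b (w r) * ((p + 1) * r * w r)
        ≤ M * (w r ^ (q - 1) * w r) * ((p + 1) * r * w r) := by gcongr
      _ = M * ((p + 1) * (r * w r ^ (q - 1))) * w r ^ 2 := by ring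
      _ ≤ _ := by gcongr
  have h3 := mul_lt_mul_of_pos_right hM2 (pow_pos hw 2)
  linarith

/-- Near the origin `u` is close to `1` and `r * w` to `0`, so the gradient contribution to the
Pohozaev derivative is nonpositive there. This starts the barrier argument. -/
theorem exists_near_zero (hc : IsClampedProfile n p q M b u w K h) (hM : 0 < M) :
    ∃ r₀ : ℝ, 0 < r₀ ∧ r₀ ≤ 1 ∧ ∀ r, 0 ≤ r → r ≤ r₀ →
      0 < K r ∧ (p + 1) * r * w r < (n + 1) * u r := by
  have hu0 := hc.u_zero
  have huc := hc.continuous_u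
  have hwc := hc.continuous_w
  have hKz : (n + 1) * K 0 = h 0 := hc.K_zero
  have hKpos : 0 < K 0 := by
    have h1 : 1 ≤ h 0 := by
      have h2 := clampedPow_nonneg q b (w 0)
      have h3 := mul_nonneg hM.le h2
      rw [hc.h_eq, hu0, clampedPow_of_mem zero_le_one le_rfl, Real.one_rpow]
      linarith
    exact pos_of_mul_pos_right (by linarith : 0 < (n + 1) * K 0) (by positivity)
  have h1 : ∀ᶠ r in 𝓝 (0 : ℝ), 0 < K r := hc.continuous_K.continuousAt.eventually (lt_mem_nhds hKpos)
  have h2 : ∀ᶠ r in 𝓝 (0 : ℝ), (p + 1) * r * w r < (n + 1) * u r := by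
    have hc1 : Continuous fun r => (p + 1) * r * w r := by fun_prop
    have hc2 : Continuous fun r => (n + 1) * u r := by fun_prop
    refine hc1.continuousAt.eventually_lt hc2.continuousAt ?_
    simp only [mul_zero, zero_mul, hu0]
    positivity
  obtain ⟨ε, hε, hball⟩ := Metric.eventually_nhds_iff.1 (h1.and h2)
  refine ⟨min (ε / 2) 1, by positivity, min_le_right _ _, fun r hr hr' => hball ?_⟩
  rw [Real.dist_eq, sub_zero, abs_of_nonneg hr]
  have := hr'.trans (min_le_left _ _)
  linarith

theorem pos_and_le (hc : IsClampedProfile n p q M b u w K h) (hp : 1 < p) (hq1 : 1 < q)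
    (hq : 2 * p / (p + 1) ≤ q) (hM : 0 < M) {C : ℝ}
    (hC : 2 ^ (q - 1) + (((n : ℝ) + 1) * (((n : ℝ) + 1) * (n + 1)) ^ (1 / (p - 1))) ^ (q - 1) ≤ C)
    (hM2 : M * ((p + 1) * C) < (n + 1) * (p - 1) / 2 - (p + 1)) (hb : n + 2 ≤ b) {r : ℝ}
    (hr : 0 ≤ r) : 0 < u r ∧ w r ≤ b := by
  have hd : 0 < ((n : ℝ) + 1) * (p - 1) / 2 - (p + 1) := by
    refine lt_of_le_of_lt ?_ hM2
    have : 0 ≤ C := le_trans (by positivity) hC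
    positivity
  have hwz : w 0 = 0 := by rw [hc.w_eq 0 le_rfl, zero_mul]
  have hJc := hc.continuous_pohozaev hp
  obtain ⟨r₀, hr₀, hr₀1, hnear⟩ := hc.exists_near_zero hM
  have hJr₀ : pohozaev n p u w r₀ < 0 := by
    have hanti : StrictAntiOn (pohozaev n p u w) (Icc 0 r₀) := by
      refine strictAntiOn_of_deriv_neg (convex_Icc 0 r₀) hJc.continuousOn fun s hs => ?_
      rw [interior_Icc] at hs
      rw [(hc.hasDerivAt_pohozaev hp hs.1).deriv]
      obtain ⟨h1, h2⟩ := hnear s hs.1.le hs.2.le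
      refine mul_neg_of_pos_of_neg (pow_pos hs.1 n) ?_
      have hws : 0 < w s := by
        rw [hc.w_eq s hs.1.le]
        exact mul_pos hs.1 h1
      have h3 := mul_nonneg hM.le (clampedPow_nonneg q b (w s))
      have h4 := mul_nonpos_of_nonneg_of_nonpos h3 (sub_neg.2 h2).le
      have h5 := mul_pos hd (pow_pos hws 2)
      linarith
    have := hanti (left_mem_Icc.2 hr₀.le) (right_mem_Icc.2 hr₀.le) hr₀
    simpa [pohozaev, hwz] using this
  -- The constant `pohozaev n p u w r₀` is a barrier: at any contact point the function is negative,
  -- hence strictly decreasing.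
  have hJall : ∀ r, r₀ ≤ r → pohozaev n p u w r < 0 := fun r hr => by
    refine lt_of_le_of_lt ?_ hJr₀
    exact image_le_of_deriv_right_lt_deriv_boundary' (f := pohozaev n p u w) (a := r₀) (b := r)
      (B := fun _ => pohozaev n p u w r₀) (B' := fun _ => 0) hJc.continuousOn
      (fun x hx => (hc.hasDerivAt_pohozaev hp (hr₀.trans_le hx.1)).hasDerivWithinAt) le_rfl continuousOn_const
      (fun x _ => hasDerivWithinAt_const _ _ _)
      (fun x hx hxe => hc.deriv_pohozaev_neg hp hq1 hq hM hC hM2 (hr₀.trans_le hx.1) (hxe ▸ hJr₀)) (right_mem_Icc.2 hr)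
  constructor
  · rcases le_total r r₀ with h1 | h1
    · have h2 := (hnear r hr h1).2
      have h3 : 0 ≤ (p + 1) * r * w r := by
        have := hc.w_nonneg hr
        positivity
      exact pos_of_mul_pos_right (h3.trans_lt h2) (by positivity)
    · exact (hc.bounds_of_pohozaev_neg hp (hr₀.trans_le h1) (hJall r h1)).1
  -- For `r ≤ 1`, `w = r * K ≤ 2`; for `r ≥ 1`, `w ≤ r * w ≤ (n + 1) * u ≤ n + 1`. Both lie below `n
  -- + 2 ≤ b`.
  · rcases le_total r 1 with h1 | h1
    · rw [hc.w_eq r hr]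
      have h2 : r * K r ≤ 1 * 2 := by
        gcongr
        · exact hc.K_nonneg r hr
        · exact hc.K_le r
      linarith
    · obtain ⟨-, h2, h3⟩ := hc.bounds_of_pohozaev_neg hp (by linarith) (hJall r (hr₀1.trans h1))
      have h4 := hc.le_one r hr
      nlinarith

end IsClampedProfile

/-! ### Existence theorem and conclusion -/

theorem exists_radialGroundState_of_supercritical {N : ℕ} {p q : ℝ} (hN : 3 ≤ N)
    (hps : ((N : ℝ) + 2) / ((N : ℝ) - 2) < p) (hq : 2 * p / (p + 1) ≤ q) :
    ∃ M₀ : ℝ, 0 < M₀ ∧ ∀ M : ℝ, 0 < M → M < M₀ →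
      ∃ u : EuclideanSpace ℝ (Fin N) → ℝ, IsRadialGroundState N p q M u ∧ u 0 = 1 := by
  obtain ⟨n, rfl⟩ := Nat.exists_eq_add_of_le' (show 1 ≤ N by omega)
  have hn : (2 : ℝ) ≤ n := by exact_mod_cast (show 2 ≤ n by omega)
  push_cast at hps
  rw [div_lt_iff₀ (by linarith)] at hps
  have hp : 1 < p := by
    by_contra! hp
    nlinarith
  have hq1 : 1 < q := by
    refine lt_of_lt_of_le ?_ hq
    rw [lt_div_iff₀ (by linarith)]
    linarith
  set d : ℝ := (n + 1) * (p - 1) / 2 - (p + 1) with hd_def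
  have hd : 0 < d := by
    rw [hd_def]
    nlinarith
  set A : ℝ := (((n : ℝ) + 1) * (((n : ℝ) + 1) * (n + 1)) ^ (1 / (p - 1))) ^ (q - 1) with hA
  set b : ℝ := n + 3 with hb
  have hb0 : 0 < b := by linarith
  set C : ℝ := 2 ^ (q - 1) + A with hC
  have hC0 : 0 < C := by positivity
  -- The first threshold bounds the truncated gradient term by `1`; the second makes the Pohozaev
  -- barrier work.
  refine ⟨min (1 / b ^ q) (d / ((p + 1) * C)), by positivity, fun M hM hMlt => ?_⟩
  have hM1 : M * b ^ q ≤ 1 := by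
    have := (hMlt.trans_le (min_le_left _ _)).le
    rwa [le_div_iff₀ (by positivity)] at this
  have hM2 : M * ((p + 1) * C) < d := by
    have := hMlt.trans_le (min_le_right _ _)
    rwa [lt_div_iff₀ (by positivity)] at this
  obtain ⟨u, w, K, h, hc⟩ := exists_isClampedProfile n hp hq1 hM hb0 hM1
  have hpos : ∀ r, 0 ≤ r → 0 < u r ∧ w r ≤ b := fun r hr =>
    hc.pos_and_le hp hq1 hq hM le_rfl hM2 (by linarith) hr
  obtain ⟨hC2, hlap, hgrad⟩ := radial_solution_of_integrated (n := n) (u := u) (K := K) (h := h)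
    hc.continuous_K hc.continuous_h hc.K_zero
    (fun r hr => by rw [← hc.w_eq r hr]; exact hc.hasDerivAt_u r) hc.hasDerivAt_K
  refine ⟨fun x => u ‖x‖, ⟨⟨hC2, fun x => ?_⟩, fun x => (hpos _ (norm_nonneg x)).1,
    fun x y hxy => by simp only [hxy]⟩, by simp [hc.u_zero]⟩
  have hx := norm_nonneg x
  have hu := (hpos _ hx).1
  rw [hlap, hgrad, norm_smul, Real.norm_eq_abs, abs_neg, abs_of_nonneg (hc.K_nonneg _ hx),
    mul_comm (K ‖x‖), ← hc.w_eq _ hx, abs_of_pos hu, Real.rpow_sub_one hu.ne',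
    div_mul_cancel₀ _ hu.ne']
  -- Both truncations are inactive since `0 < u ≤ 1` and `0 ≤ w ≤ b`.
  rw [hc.h_eq, clampedPow_of_mem hu.le (hc.le_one _ hx), clampedPow_of_mem (hc.w_nonneg hx) ((hpos _ hx).2)]

end GroundStates

theorem theoremF :
    -- Part 1
    (∀ (N : ℕ) (p q : ℝ), 1 ≤ N → 1 < p → 2 * p / (p + 1) < q →
      ∃ M₀ : ℝ, 0 < M₀ ∧ ∀ M : ℝ, M₀ < M →
        ¬ ∃ u : EuclideanSpace ℝ (Fin N) → ℝ, IsRadialGroundState N p q M u ∧ u 0 = 1) ∧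
    -- Part 2, the case `q ≤ p`
    (∀ (N : ℕ) (p q : ℝ), 1 ≤ N → 1 < p → (3 ≤ N → p < ((N : ℝ) + 2) / ((N : ℝ) - 2)) →
      1 < q → q ≤ p →
      ∀ M : ℝ, 0 < M →
        ¬ ∃ u : EuclideanSpace ℝ (Fin N) → ℝ, IsRadialGroundState N p q M u) ∧
    -- Part 2, the case `q > p`
    (∀ (N : ℕ) (p q : ℝ), 1 ≤ N → 1 < p → (3 ≤ N → p < ((N : ℝ) + 2) / ((N : ℝ) - 2)) →
      p < q →
      ∃ M₀ : ℝ, 0 < M₀ ∧ ∀ M : ℝ, 0 < M → M < M₀ →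
        ¬ ∃ u : EuclideanSpace ℝ (Fin N) → ℝ, IsRadialGroundState N p q M u ∧ u 0 = 1) ∧
    -- Part 3
    (∀ (N : ℕ) (p q : ℝ), 3 ≤ N → ((N : ℝ) + 2) / ((N : ℝ) - 2) < p → 2 * p / (p + 1) ≤ q →
      ∃ M₀ : ℝ, 0 < M₀ ∧ ∀ M : ℝ, 0 < M → M < M₀ →
        ∃ u : EuclideanSpace ℝ (Fin N) → ℝ, IsRadialGroundState N p q M u ∧ u 0 = 1) := by
  refine ⟨fun N p q hN hp hq => not_exists_radialGroundState_of_large hN hp hq,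
    fun N p q hN hp hps hq1 hqp M hM =>
      not_exists_radialGroundState_of_subcritical hN hp hps hq1 hqp hM,
    fun N p q hN hp hps hpq => not_exists_radialGroundState_of_small hN hp hps hpq,
    fun N p q hN hps hq => exists_radialGroundState_of_supercritical hN hps hq⟩
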